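/- Let $\mathbb N=\{1,2,3,\dots\}$ and $Q\subseteq\mathbb N$. Let $(A_q)$ and $(B_q)$ be sequences of integers with $B_q>0$ and $\gcd(A_q,B_q)=1$ for all $q$, let $\psi\colon Q\to[0,\tfrac12)$ be a function satisfying $$\sum_{q\in Q}\psi(q)\prod_{p\mid q,\ p\nmid B_q}\Bigl(1-\frac1p\Bigr)<\infty,$$ where the product is over primes $p$, and let $\theta\colon Q\to\mathbb R$ be an arbitrary function. Let $W_Q^*(\psi,\theta)$ be the set of all $x\in[0,1]$ such that $$\Bigl|x-\frac{p+\theta(q)}{q}\Bigr|<\frac{\psi(q)}{q}\quad\text{for infinitely many }(p,q)\in\mathbb Z\times Q\text{ with }\gcd(B_qp+A_q,q)=1,$$ and put $$s(Q,\psi)=\inf\Bigl\{s\ge 0:\ \sum_{q\in Q}\Bigl(\frac{\psi(q)}{q}\Bigr)^s<\infty\Bigr\}.$$ Then $$\dim_{\mathrm F}W_Q^*(\psi,\theta)=\min\{2s(Q,\psi),1\}.$$ Here, for $E\subseteq\mathbb R$, the Fourier dimension $\dim_{\mathrm F}E$ is the supremum (taken to be $0$ if there is no such $s$) of all $s\in[0,1]$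 for which there are a Borel probability measure $\nu$ on $\mathbb R$ with $\nu(\mathbb R\setminus E)=0$ and a constant $C$ with $\bigl|\int e^{-2\pi i\xi x}\,d\nu(x)\bigr|\le C(1+|\xi|)^{-s/2}$ for all $\xi\in\mathbb R$. -/

import Mathlib

open MeasureTheory Set

noncomputable section

/-- The Fourier transform `ξ ↦ ∫ exp (-2πi ξ x) dν(x)` of a measure on the real line. -/
def measureFourier (ν : Measure ℝ) (ξ : ℝ) : ℂ :=
  ∫ x : ℝ, Complex.exp (-2 * (Real.pi : ℂ) * Complex.I * (ξ : ℂ) * (x : ℂ)) ∂ν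

/-- The Fourier dimension of a subset `E` of the real line: the supremum of all `s ∈ [0, 1]` for
which some Borel probability measure `ν` giving full measure to `E` has Fourier transform
`O((1 + |ξ|) ^ (-s / 2))` on the whole line. The set of such `s` is bounded by `1`; if it is empty
(for example for `E = ∅`), the supremum is `0`, the usual convention. -/
def fourierDim (E : Set ℝ) : ℝ :=
  sSup {s : ℝ | s ∈ Icc (0 : ℝ) 1 ∧
    ∃ ν : Measure ℝ, IsProbabilityMeasure ν ∧ ν Eᶜ = 0 ∧
      ∃ C : ℝ, ∀ ξ : ℝ, ‖measureFourier ν ξ‖ ≤ C * (1 + |ξ|) ^ (-s / 2)}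

/-- The infimum of all `s ≥ 0` for which the sum of `(ψ(q) / q) ^ s` over `q ∈ Q` converges.
(The value given to `0 ^ 0` does not influence the infimum.) -/
def convExponent (Q : Set ℕ) (ψ : Q → ℝ) : ℝ :=
  sInf {s : ℝ | 0 ≤ s ∧ Summable fun q : Q => (ψ q / ((q : ℕ) : ℝ)) ^ s}

/-- The set of all `x ∈ [0, 1]` with `|x - (p + θ(q)) / q| < ψ(q) / q` for infinitely many pairs
`(p, q) ∈ ℤ × Q` with `gcd (B_q p + A_q, q) = 1`. -/
def approxSet (Q : Set ℕ) (ψ θ : Q → ℝ) (A B : ℕ → ℤ) : Set ℝ :=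
  {x : ℝ | x ∈ Icc (0 : ℝ) 1 ∧
    {pq : ℤ × Q |
      |x - ((pq.1 : ℝ) + θ pq.2) / ((pq.2 : ℕ) : ℝ)| < ψ pq.2 / ((pq.2 : ℕ) : ℝ) ∧
      Int.gcd (B pq.2 * pq.1 + A pq.2) ((pq.2 : ℕ) : ℤ) = 1}.Infinite}

/-- The product of `1 - 1 / p` over all primes `p` with `p ∣ q` and `p ∤ b`. -/
def coprimeDensity (q : ℕ) (b : ℤ) : ℝ :=
  ∏ p ∈ q.primeFactors.filter (fun p : ℕ => ¬ ((p : ℤ) ∣ b)), (1 - 1 / (p : ℝ))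

end

/-! Both inequalities rest on one exponential sum: the sum of `exp (-2πi n (p + θ) / q)` over the
admissible residues `p` modulo `q` is at most the sum of the common divisors of `q` and `n`
(`norm_residueSum_le`). It is a shifted Ramanujan-type sum, handled by sieving over the primes that
divide `q` but not `b`. Tents placed around the admissible points turn this bound into information
about measures.

Upper bound (`fourierDim_exponent_le`). If the transform of `ν` decays like `|ξ| ^ (-s/2)`, Fourier
expansion of the tents bounds the `ν`-measure of the points within `ψ(q)/q` of an admissible point
by a multiple of `ψ(q)` times the coprime density, plus a multiple of `d(q) (ψ(q)/q) ^ (s/2)`, where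
`d` counts divisors. The first terms are summable by hypothesis. If `s/2` exceeds the convergence
exponent, the divisor bound makes the second terms summable too. By Borel–Cantelli, almost every
point is then approximated for only finitely many `q`, so `ν` cannot live on the set.

Lower bound (`exists_measure_approxSet`). For `s` below the convergence exponent, infinitely many
dyadic ranges of `ψ(q)/q` contain many `q`. Averaging the normalized tent combs over such a range
gives a nonnegative periodic function of mean one whose other Fourier coefficients are at most `ε (1
+ |n|) ^ (-s)`, with `ε` as small as desired: for fixed `n ≠ 0`, few `q` share large divisors with
`n`. Multiplying a smooth density successively by such functions changes its transform by at most a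
small multiple of `(1 + |ξ|) ^ (-s)` each time. A weak limit of the products lives on the
approximation set and keeps the decay (`exists_measure_of_multipliers`), which gives Fourier
dimension at least `2s`. -/

/-! ### Characters and the Fourier series of a periodic tent -/

/-- The additive character `x ↦ exp (2πi x)` of the real line. -/
noncomputable def unitExp (x : ℝ) : ℂ := Complex.exp (2 * (Real.pi : ℂ) * Complex.I * (x : ℂ))

lemma unitExp_zero : unitExp 0 = 1 := by simp [unitExp]

lemma unitExp_add (x y : ℝ) : unitExp (x + y) = unitExp x * unitExp y := by
  rw [unitExp, unitExp, unitExp, ← Complex.exp_add]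
  congr 1
  push_cast
  ring

lemma norm_unitExp (x : ℝ) : ‖unitExp x‖ = 1 := by
  have : 2 * (Real.pi : ℂ) * Complex.I * (x : ℂ) = ((2 * Real.pi * x : ℝ) : ℂ) * Complex.I := by
    push_cast
    ring
  rw [unitExp, this, Complex.norm_exp_ofReal_mul_I]

lemma unitExp_eq_one_iff (x : ℝ) : unitExp x = 1 ↔ ∃ n : ℤ, x = n := by
  rw [unitExp, Complex.exp_eq_one_iff]
  refine exists_congr fun n => ⟨fun h => ?_, fun h => by rw [h]; push_cast; ring⟩
  have h2 : (2 * (Real.pi : ℂ) * Complex.I) ≠ 0 := Complex.two_pi_I_ne_zero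
  have h3 : (x : ℂ) = n := by
    apply mul_left_cancel₀ h2
    rw [h]
    ring
  exact_mod_cast h3

lemma unitExp_intCast (n : ℤ) : unitExp n = 1 := (unitExp_eq_one_iff _).2 ⟨n, rfl⟩

lemma continuous_unitExp : Continuous unitExp := by
  unfold unitExp
  fun_prop

lemma unitExp_nat_mul (n : ℕ) (x : ℝ) : unitExp (n * x) = unitExp x ^ n := by
  rw [unitExp, unitExp, ← Complex.exp_nat_mul]
  congr 1
  push_cast
  ring

lemma measureFourier_eq (ν : Measure ℝ) (ξ : ℝ) :
    measureFourier ν ξ = ∫ x, unitExp (-(ξ * x)) ∂ν := by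
  unfold measureFourier unitExp
  congr 1
  ext x
  congr 1
  push_cast
  ring

/-- This is the Fourier series of the second Bernoulli polynomial, extended evenly to `[-1, 1]` so
that it also applies to the shifts `y ± η` below. The term `n = 0` vanishes because `1 / 0 = 0`. -/
lemma hasSum_inv_sq_unitExp {z : ℝ} (hz : |z| ≤ 1) :
    HasSum (fun n : ℤ => 1 / (n : ℂ) ^ 2 * unitExp (n * z))
      ((2 * Real.pi ^ 2 * (z ^ 2 - |z| + 1 / 6) : ℝ) : ℂ) := by
  have key : ∀ z : ℝ, 0 ≤ z → z ≤ 1 → HasSum (fun n : ℤ => 1 / (n : ℂ) ^ 2 * unitExp (n * z))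
      ((2 * Real.pi ^ 2 * (z ^ 2 - |z| + 1 / 6) : ℝ) : ℂ) := by
    intro z h0 h1
    have h := hasSum_one_div_pow_mul_fourier_mul_bernoulliFun (le_refl 2) (x := z) ⟨h0, h1⟩
    convert h using 1
    · ext n
      rw [fourier_coe_apply, unitExp]
      congr 2
      push_cast
      simp
      ring
    · rw [bernoulliFun_two, abs_of_nonneg h0]
      push_cast
      rw [mul_pow, Complex.I_sq]
      norm_num [Nat.factorial]
      left
      ring
  rcases le_total 0 z with h | h
  · exact key z h ((le_abs_self z).trans hz)
  · have := key (-z) (by linarith) ((neg_le_abs z).trans hz)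
    rw [← (Equiv.neg ℤ).hasSum_iff] at this
    convert this using 1
    · ext n
      simp
    · rw [abs_neg]
      simp

/-- The `1`-periodic tent function of half-width `η` and integral one. -/
noncomputable def periodicTent (η x : ℝ) : ℝ := max 0 (1 - ‖(x : UnitAddCircle)‖ / η) / η

lemma continuous_periodicTent (η : ℝ) : Continuous (periodicTent η) := by
  have : Continuous fun x : ℝ => (x : UnitAddCircle) := AddCircle.continuous_mk' 1
  unfold periodicTent
  fun_prop

lemma periodicTent_nonneg {η : ℝ} (hη : 0 < η) (x : ℝ) : 0 ≤ periodicTent η x :=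
  div_nonneg (le_max_left _ _) hη.le

lemma periodicTent_sub_intCast (η x : ℝ) (m : ℤ) :
    periodicTent η (x - m) = periodicTent η x := by
  have : ((x - m : ℝ) : UnitAddCircle) = (x : UnitAddCircle) := by
    rw [AddCircle.coe_sub, sub_eq_self]
    exact (AddCircle.coe_eq_zero_iff 1).2 ⟨m, by simp⟩
  simp [periodicTent, this]

lemma exists_int_of_periodicTent_ne_zero {η x : ℝ} (hη : 0 < η) (h : periodicTent η x ≠ 0) :
    ∃ m : ℤ, |x - m| < η := by
  refine ⟨round x, ?_⟩
  by_contra! hle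
  apply h
  rw [periodicTent, UnitAddCircle.norm_eq, max_eq_left, zero_div]
  rw [sub_nonpos, le_div_iff₀ hη]
  simpa using hle

lemma le_periodicTent {δ x : ℝ} (hδ : 0 < δ) (h : |x| ≤ δ) :
    1 / (4 * δ) ≤ periodicTent (2 * δ) x := by
  have h1 : ‖(x : UnitAddCircle)‖ ≤ δ := by
    rw [UnitAddCircle.norm_eq]
    have := round_le x 0
    simp at this
    linarith
  have h2 : ‖(x : UnitAddCircle)‖ / (2 * δ) ≤ 1 / 2 := by
    rw [div_le_iff₀ (by positivity)]
    linarith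
  rw [periodicTent]
  calc 1 / (4 * δ) = (1 / 2) / (2 * δ) := by ring
    _ ≤ _ := by
      gcongr
      exact le_max_of_le_right (by linarith)

/-- The tent is a second difference, with step `η`, of the Bernoulli kernel. Differencing multiplies
the coefficient `1 / n ^ 2` by a multiple of `sin (π η n) ^ 2`, which produces the squared `sinc`.
-/
lemma hasSum_periodicTent {η : ℝ} (hη : 0 < η) (hη' : η ≤ 1 / 2) (x : ℝ) :
    HasSum (fun n : ℤ => ((Real.sinc (Real.pi * η * n) ^ 2 : ℝ) : ℂ) * unitExp (n * x))
      (periodicTent η x : ℂ) := by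
  set y : ℝ := x - round x with hy
  have hyl : |y| ≤ 1 / 2 := abs_sub_round x
  obtain ⟨hy1, hy2⟩ := abs_le.1 hyl
  have hexp : ∀ n : ℤ, unitExp (n * x) = unitExp (n * y) := by
    intro n
    have : (n : ℝ) * x = n * y + ((n * round x : ℤ) : ℝ) := by
      rw [hy]
      push_cast
      ring
    rw [this, unitExp_add, unitExp_intCast, mul_one]
  have h0 := hasSum_inv_sq_unitExp (z := y) (by linarith)
  have h1 := hasSum_inv_sq_unitExp (z := y + η) (abs_le.2 ⟨by linarith, by linarith⟩)
  have h2 := hasSum_inv_sq_unitExp (z := y - η) (abs_le.2 ⟨by linarith, by linarith⟩)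
  -- The constant mode is added separately: it cancels the `-1` left by the quadratic parts in the
  -- second difference.
  have hs : HasSum (fun n : ℤ => if n = 0 then (1 : ℂ) else 0) 1 := hasSum_ite_eq 0 1
  have hpi := Real.pi_pos
  have H := hs.add ((((h0.mul_left 2).sub h1).sub h2).mul_left
    ((1 / (4 * Real.pi ^ 2 * η ^ 2) : ℝ) : ℂ))
  convert H using 1
  · ext n
    by_cases hn : n = 0
    · simp [hn, unitExp_zero]
    · have hn' : (n : ℝ) ≠ 0 := by exact_mod_cast hn
      have hn'' : (n : ℂ) ≠ 0 := by exact_mod_cast hn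
      have e1 : (n : ℝ) * (y + η) = n * y + n * η := by ring
      have e2 : (n : ℝ) * (y - η) = n * y + -(n * η) := by ring
      have hsin : unitExp (n * η) + unitExp (-(n * η)) =
          ((2 - 4 * Real.sin (Real.pi * η * n) ^ 2 : ℝ) : ℂ) := by
        have : 2 - 4 * Real.sin (Real.pi * η * n) ^ 2 = 2 * Real.cos (2 * (Real.pi * η * n)) := by
          rw [Real.cos_two_mul, Real.cos_sq']
          ring
        rw [this]
        push_cast
        rw [Complex.cos, unitExp, unitExp]
        push_cast
        rw [show (2 : ℂ) * Real.pi * Complex.I * (n * η) = 2 * (Real.pi * η * n) * Complex.I by ring,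
          show (2 : ℂ) * Real.pi * Complex.I * -(n * η) = -(2 * (Real.pi * η * n)) * Complex.I by ring]
        ring
      have hη0 : (η : ℂ) ≠ 0 := by exact_mod_cast hη.ne'
      have hpi0 : (Real.pi : ℂ) ≠ 0 := by exact_mod_cast hpi.ne'
      rw [if_neg hn, zero_add, hexp, e1, e2, unitExp_add, unitExp_add,
        Real.sinc_of_ne_zero (by positivity)]
      have : unitExp (n * η) = ((2 - 4 * Real.sin (Real.pi * η * n) ^ 2 : ℝ) : ℂ)
          - unitExp (-(n * η)) := by rw [← hsin]; ring
      rw [this]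
      push_cast
      field_simp
      ring
  · have hval : periodicTent η x = (|y + η| + |y - η| - 2 * |y|) / (2 * η ^ 2) := by
      rw [periodicTent, UnitAddCircle.norm_eq, ← hy, eq_div_iff (by positivity)]
      have : max 0 (1 - |y| / η) / η * (2 * η ^ 2) = 2 * max 0 (η - |y|) := by
        rw [show η - |y| = η * (1 - |y| / η) by field_simp,
          show (0 : ℝ) = η * 0 by ring, ← mul_max_of_nonneg _ _ hη.le]
        simp only [mul_zero]
        field_simp
      rw [this]
      rcases abs_cases y with h | h <;> rcases abs_cases (y + η) with h' | h' <;>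
        rcases abs_cases (y - η) with h'' | h'' <;>
        rcases max_cases 0 (η - |y|) with h3 | h3 <;> linarith
    rw [hval, ← Complex.ofReal_one, show (2 : ℂ) = ((2 : ℝ) : ℂ) by simp]
    norm_cast
    field_simp
    ring

lemma sinc_sq_le_one (u : ℝ) : Real.sinc u ^ 2 ≤ 1 :=
  (sq_le_one_iff_abs_le_one _).2 (Real.abs_sinc_le_one u)

lemma sinc_sq_le_inv_sq {u : ℝ} (hu : u ≠ 0) : Real.sinc u ^ 2 ≤ 1 / u ^ 2 := by
  rw [Real.sinc_of_ne_zero hu, div_pow]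
  gcongr
  exact Real.sin_sq_le_one u

/-! ### Sieving the admissible residues -/

/-- The residues `p` modulo `q` for which `b * p + a` is coprime to `q`. -/
def goodResidues (q : ℕ) (a b : ℤ) : Finset ℕ :=
  (Finset.range q).filter fun p => Int.gcd (b * p + a) q = 1

/-- The primes that divide `q` and do not divide `b`. -/
def sievePrimes (q : ℕ) (b : ℤ) : Finset ℕ :=
  q.primeFactors.filter fun p : ℕ => ¬ ((p : ℤ) ∣ b)

lemma prime_of_mem_sievePrimes {q : ℕ} {b : ℤ} {l : ℕ} (h : l ∈ sievePrimes q b) : l.Prime :=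
  Nat.prime_of_mem_primeFactors (Finset.mem_filter.1 h).1

/-- A prime dividing both `q` and `b` never divides `b * p + a`, since it would then divide `gcd a b
= 1`. Only the remaining primes of `q` impose a condition. -/
lemma gcd_eq_one_iff_forall_sievePrimes {q : ℕ} (hq : 0 < q) {a b : ℤ} (hab : Int.gcd a b = 1)
    (p : ℤ) : Int.gcd (b * p + a) q = 1 ↔ ∀ l ∈ sievePrimes q b, ¬ ((l : ℤ) ∣ b * p + a) := by
  constructor
  · intro h l hl hd
    have hlq : (l : ℤ) ∣ q :=
      Int.natCast_dvd_natCast.2 (Nat.dvd_of_mem_primeFactors (Finset.mem_filter.1 hl).1)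
    have := Int.dvd_coe_gcd hd hlq
    rw [h] at this
    exact (prime_of_mem_sievePrimes hl).one_lt.ne' (by simpa using Int.natCast_dvd_natCast.1 this)
  · intro h
    by_contra hne
    obtain ⟨l, hl, hd⟩ := Nat.exists_prime_and_dvd hne
    have h1 : (l : ℤ) ∣ b * p + a := (Int.natCast_dvd_natCast.2 hd).trans (Int.gcd_dvd_left ..)
    have h2 : (l : ℤ) ∣ q := (Int.natCast_dvd_natCast.2 hd).trans (Int.gcd_dvd_right ..)
    refine h l (Finset.mem_filter.2 ⟨Nat.mem_primeFactors.2
      ⟨hl, Int.natCast_dvd_natCast.1 h2, hq.ne'⟩, fun h3 => ?_⟩) h1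
    have h4 : (l : ℤ) ∣ a := (dvd_add_right (h3.mul_right p)).1 h1
    have := Int.dvd_coe_gcd h4 h3
    rw [hab] at this
    exact hl.one_lt.ne' (by simpa using Int.natCast_dvd_natCast.1 this)

lemma prod_primes_int_dvd_iff {t : Finset ℕ} (ht : ∀ l ∈ t, l.Prime) (z : ℤ) :
    ((∏ l ∈ t, l : ℕ) : ℤ) ∣ z ↔ ∀ l ∈ t, (l : ℤ) ∣ z := by
  constructor
  · intro h l hl
    exact (Int.natCast_dvd_natCast.2 (Finset.dvd_prod_of_mem _ hl)).trans h
  · intro h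
    rw [Int.natCast_dvd]
    refine Finset.prod_primes_dvd _ (fun l hl => (ht l hl).prime) fun l hl => ?_
    exact Int.natCast_dvd.1 (h l hl)

lemma prod_sievePrimes_dvd {q : ℕ} {b : ℤ} {t : Finset ℕ} (ht : t ⊆ sievePrimes q b) :
    ∏ l ∈ t, l ∣ q :=
  Finset.prod_primes_dvd _ (fun _ hl => (prime_of_mem_sievePrimes (ht hl)).prime)
    fun _ hl => Nat.dvd_of_mem_primeFactors (Finset.mem_filter.1 (ht hl)).1

lemma gcd_prod_sievePrimes {q : ℕ} {b : ℤ} {t : Finset ℕ} (ht : t ⊆ sievePrimes q b) :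
    Int.gcd ((∏ l ∈ t, l : ℕ) : ℤ) b = 1 := by
  rw [Int.gcd_eq_natAbs, Int.natAbs_natCast]
  refine Nat.Coprime.prod_left fun l hl => ?_
  rw [(prime_of_mem_sievePrimes (ht hl)).coprime_iff_not_dvd, ← Int.natCast_dvd]
  exact (Finset.mem_filter.1 (ht hl)).2

lemma prod_injOn_powerset_sievePrimes (q : ℕ) (b : ℤ) :
    InjOn (fun t : Finset ℕ => ∏ l ∈ t, l) ((sievePrimes q b).powerset : Set (Finset ℕ)) := by
  intro t ht u hu h
  rw [Finset.mem_coe, Finset.mem_powerset] at ht hu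
  have h' : ∏ l ∈ t, l = ∏ l ∈ u, l := h
  rw [← Nat.primeFactors_prod fun l hl => prime_of_mem_sievePrimes (ht hl), h',
    Nat.primeFactors_prod fun l hl => prime_of_mem_sievePrimes (hu hl)]

lemma sum_goodResidues {q : ℕ} (hq : 0 < q) {a b : ℤ} (hab : Int.gcd a b = 1) (f : ℕ → ℂ) :
    ∑ p ∈ goodResidues q a b, f p = ∑ t ∈ (sievePrimes q b).powerset, (-1) ^ t.card *
      ∑ p ∈ (Finset.range q).filter (fun p : ℕ => ((∏ l ∈ t, l : ℕ) : ℤ) ∣ b * p + a), f p := by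
  have key : ∀ p : ℕ, (if Int.gcd (b * p + a) q = 1 then f p else 0) =
      ∑ t ∈ (sievePrimes q b).powerset, (-1) ^ t.card *
        (if ((∏ l ∈ t, l : ℕ) : ℤ) ∣ b * p + a then f p else 0) := by
    intro p
    -- Inclusion–exclusion: the indicator is the product of `1 - 1_{l ∣ b p + a}`, expanded over
    -- subsets of the sieving primes.
    have h1 : (if Int.gcd (b * p + a) q = 1 then (1 : ℂ) else 0) =
        ∏ l ∈ sievePrimes q b, (-(if (l : ℤ) ∣ b * p + a then (1 : ℂ) else 0) + 1) := by
      have hiff := gcd_eq_one_iff_forall_sievePrimes hq hab p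
      split_ifs with h
      · rw [Finset.prod_eq_one]
        intro l hl
        rw [if_neg (hiff.1 h l hl)]
        simp
      · rw [hiff] at h
        push Not at h
        obtain ⟨l, hl, hd⟩ := h
        rw [Finset.prod_eq_zero hl]
        simp [hd]
    have h2 : (if Int.gcd (b * p + a) q = 1 then f p else 0) =
        (if Int.gcd (b * p + a) q = 1 then (1 : ℂ) else 0) * f p := by
      split_ifs <;> simp
    rw [h2, h1, Finset.prod_add, Finset.sum_mul]
    refine Finset.sum_congr rfl fun t ht => ?_
    rw [Finset.mem_powerset] at ht
    rw [Finset.prod_neg, Finset.prod_const_one, mul_one, mul_assoc]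
    congr 1
    have h3 := prod_primes_int_dvd_iff (fun l hl => prime_of_mem_sievePrimes (ht hl)) (b * p + a)
    split_ifs with h
    · rw [Finset.prod_eq_one, one_mul]
      intro l hl
      rw [if_pos (h3.1 h l hl)]
    · rw [h3] at h
      push Not at h
      obtain ⟨l, hl, hd⟩ := h
      rw [Finset.prod_eq_zero hl, zero_mul]
      rw [if_neg hd]
  rw [goodResidues, Finset.sum_filter, Finset.sum_congr rfl fun p _ => key p, Finset.sum_comm]
  refine Finset.sum_congr rfl fun t _ => ?_
  rw [Finset.sum_filter, Finset.mul_sum]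

/-- Since `b` is invertible modulo `D`, the condition `D ∣ b p + a` selects one residue class, which
meets `[0, q)` in `q / D` points. -/
lemma exists_sum_filter_dvd_eq {q D : ℕ} (hq : 0 < q) (hD : D ∣ q) {b : ℤ}
    (hDb : Int.gcd (D : ℤ) b = 1) (a : ℤ) :
    ∃ r : ℕ, ∀ f : ℕ → ℂ, ∑ p ∈ (Finset.range q).filter (fun p : ℕ => (D : ℤ) ∣ b * p + a), f p =
      ∑ m ∈ Finset.range (q / D), f (r + D * m) := by
  have hDpos : 0 < D := Nat.pos_of_dvd_of_pos hD hq
  have hDZ : (0 : ℤ) < D := by exact_mod_cast hDpos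
  have hcop : IsCoprime (D : ℤ) b := Int.isCoprime_iff_gcd_eq_one.2 hDb
  obtain ⟨u, v, huv⟩ := id hcop
  set r : ℕ := ((-(a * v)) % D).toNat with hr
  have hrZ : (r : ℤ) = (-(a * v)) % D := Int.toNat_of_nonneg (Int.emod_nonneg _ hDZ.ne')
  have hrlt : r < D := by
    have := Int.emod_lt_of_pos (-(a * v)) hDZ
    omega
  have hrd : (D : ℤ) ∣ b * r + a := by
    have h1 : (D : ℤ) ∣ -(a * v) - r := by
      rw [hrZ]
      exact Int.dvd_self_sub_emod
    obtain ⟨c, hc⟩ := h1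
    refine ⟨a * u - b * c, ?_⟩
    have : (r : ℤ) = -(a * v) - D * c := by linarith
    rw [this]
    linear_combination (-a) * huv
  have hiff : ∀ p : ℕ, (D : ℤ) ∣ b * p + a ↔ ∃ m : ℕ, p = r + D * m := by
    intro p
    constructor
    · intro h
      have h1 : (D : ℤ) ∣ b * ((p : ℤ) - r) := by
        rw [show b * ((p : ℤ) - r) = (b * p + a) - (b * r + a) by ring]
        exact dvd_sub h hrd
      have h2 : (D : ℤ) ∣ (p : ℤ) - r := hcop.dvd_of_dvd_mul_left h1
      have h3 : r ≡ p [MOD D] := (Nat.modEq_iff_dvd).2 h2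
      have h4 : p % D = r := by rw [← h3, Nat.mod_eq_of_lt hrlt]
      exact ⟨p / D, by rw [← h4, Nat.mod_add_div]⟩
    · rintro ⟨m, rfl⟩
      have : b * ((r + D * m : ℕ) : ℤ) + a = (b * r + a) + D * (b * m) := by
        push_cast
        ring
      rw [this]
      exact dvd_add hrd (dvd_mul_right _ _)
  refine ⟨r, fun f => ?_⟩
  symm
  refine Finset.sum_bij (fun m _ => r + D * m) ?_ ?_ ?_ ?_
  · intro m hm
    rw [Finset.mem_range] at hm
    rw [Finset.mem_filter, Finset.mem_range]
    refine ⟨?_, (hiff _).2 ⟨m, rfl⟩⟩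
    calc r + D * m < D * (m + 1) := by linarith
      _ ≤ D * (q / D) := Nat.mul_le_mul_left _ hm
      _ = q := Nat.mul_div_cancel' hD
  · intro m _ m' _ h
    exact Nat.eq_of_mul_eq_mul_left hDpos (Nat.add_left_cancel h)
  · intro p hp
    rw [Finset.mem_filter, Finset.mem_range] at hp
    obtain ⟨m, rfl⟩ := (hiff p).1 hp.2
    refine ⟨m, ?_, rfl⟩
    rw [Finset.mem_range, Nat.lt_div_iff_mul_lt' hD]
    linarith [hp.1]
  · intro m _
    rfl

lemma card_goodResidues {q : ℕ} (hq : 0 < q) {a b : ℤ} (hab : Int.gcd a b = 1) :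
    ((goodResidues q a b).card : ℝ) = q * coprimeDensity q b := by
  have h := sum_goodResidues hq hab fun _ => 1
  have h2 : ((goodResidues q a b).card : ℂ) = ((q * coprimeDensity q b : ℝ) : ℂ) := by
    simp only [Finset.sum_const, nsmul_eq_mul, mul_one] at h
    rw [h]
    have h3 : coprimeDensity q b = ∏ l ∈ sievePrimes q b, (-(1 / (l : ℝ)) + 1) := by
      rw [coprimeDensity, sievePrimes]
      refine Finset.prod_congr rfl fun l _ => by ring
    rw [h3, Finset.prod_add, Finset.mul_sum]
    push_cast
    refine Finset.sum_congr rfl fun t ht => ?_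
    rw [Finset.mem_powerset] at ht
    have hd := prod_sievePrimes_dvd ht
    obtain ⟨r, hr⟩ := exists_sum_filter_dvd_eq hq hd (gcd_prod_sievePrimes ht) a
    have h4 := hr fun _ => 1
    simp only [Finset.sum_const, nsmul_eq_mul, mul_one, Finset.card_range] at h4
    have hne : ((∏ l ∈ t, l : ℕ) : ℂ) ≠ 0 := by
      rw [Nat.cast_ne_zero]
      exact (Nat.pos_of_dvd_of_pos hd hq).ne'
    rw [Nat.cast_prod] at h4
    rw [h4, Finset.prod_neg, Finset.prod_const_one, mul_one, Finset.prod_div_distrib,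
      Finset.prod_const_one, Nat.cast_div hd hne]
    push_cast
    ring
  exact_mod_cast h2

lemma card_powerset_sievePrimes_le {q : ℕ} (hq : 0 < q) (b : ℤ) :
    2 ^ (sievePrimes q b).card ≤ q.divisors.card := by
  rw [← Finset.card_powerset]
  refine Finset.card_le_card_of_injOn (fun t => ∏ l ∈ t, l) (fun t ht => ?_)
    (prod_injOn_powerset_sievePrimes q b)
  rw [Finset.mem_coe, Finset.mem_powerset] at ht
  exact Nat.mem_divisors.2 ⟨prod_sievePrimes_dvd ht, hq.ne'⟩

lemma inv_card_divisors_le_coprimeDensity {q : ℕ} (hq : 0 < q) (b : ℤ) :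
    1 / (q.divisors.card : ℝ) ≤ coprimeDensity q b := by
  have h1 : (1 / 2 : ℝ) ^ (sievePrimes q b).card ≤ coprimeDensity q b := by
    change _ ≤ ∏ l ∈ sievePrimes q b, _
    rw [← Finset.prod_const]
    refine Finset.prod_le_prod (fun _ _ => by norm_num) fun l hl => ?_
    have : (2 : ℝ) ≤ l := by exact_mod_cast (prime_of_mem_sievePrimes hl).two_le
    have : 1 / (l : ℝ) ≤ 1 / 2 := one_div_le_one_div_of_le (by norm_num) this
    linarith
  refine le_trans ?_ h1
  rw [one_div_pow]
  apply one_div_le_one_div_of_le (by positivity)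
  exact_mod_cast card_powerset_sievePrimes_le hq b

/-! ### Exponential sums and the divisor bound -/

/-- The exponential sum over the good residues, at the frequency `n`. -/
noncomputable def residueSum (q : ℕ) (a b : ℤ) (θ : ℝ) (n : ℤ) : ℂ :=
  ∑ p ∈ goodResidues q a b, unitExp (-(n * ((p + θ) / q)))

lemma residueSum_zero (q : ℕ) (a b : ℤ) (θ : ℝ) :
    residueSum q a b θ 0 = (goodResidues q a b).card := by
  simp [residueSum, unitExp_zero]

lemma norm_residueSum_le_card (q : ℕ) (a b : ℤ) (θ : ℝ) (n : ℤ) :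
    ‖residueSum q a b θ n‖ ≤ (goodResidues q a b).card := by
  refine (norm_sum_le _ _).trans ?_
  simp [norm_unitExp]

lemma norm_sum_range_unitExp_le {N : ℕ} (hN : 0 < N) (n : ℤ) :
    ‖∑ m ∈ Finset.range N, unitExp (-(n / N)) ^ m‖ ≤ if (N : ℤ) ∣ n then (N : ℝ) else 0 := by
  have hN0 : (N : ℝ) ≠ 0 := by exact_mod_cast hN.ne'
  split_ifs with h
  · refine (norm_sum_le _ _).trans ?_
    simp [norm_unitExp]
  · have h1 : unitExp (-(n / N)) ≠ 1 := by
      rw [Ne, unitExp_eq_one_iff]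
      rintro ⟨k, hk⟩
      apply h
      refine ⟨-k, ?_⟩
      have : (n : ℝ) = N * (-k) := by
        rw [← hk]
        field_simp
      exact_mod_cast this
    have h2 : unitExp (-(n / N)) ^ N = 1 := by
      rw [← unitExp_nat_mul, unitExp_eq_one_iff]
      refine ⟨-n, ?_⟩
      push_cast
      field_simp
    rw [geom_sum_eq h1, h2]
    simp

/-- After inclusion–exclusion, each squarefree `D` contributes a geometric sum over `q / D` equally
spaced points, which vanishes unless `q / D` divides `n`. Distinct `D` give distinct divisors `q /
D`, hence the bound. -/
lemma norm_residueSum_le {q : ℕ} (hq : 0 < q) {a b : ℤ} (hab : Int.gcd a b = 1) (θ : ℝ) (n : ℤ) :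
    ‖residueSum q a b θ n‖ ≤ ∑ d ∈ q.divisors.filter (fun d : ℕ => (d : ℤ) ∣ n), (d : ℝ) := by
  rw [residueSum, sum_goodResidues hq hab]
  have hq0 : (q : ℝ) ≠ 0 := by exact_mod_cast hq.ne'
  calc _ ≤ ∑ t ∈ (sievePrimes q b).powerset,
        (if ((q / ∏ l ∈ t, l : ℕ) : ℤ) ∣ n then ((q / ∏ l ∈ t, l : ℕ) : ℝ) else 0) := by
        refine (norm_sum_le _ _).trans (Finset.sum_le_sum fun t ht => ?_)
        rw [Finset.mem_powerset] at ht
        have hd := prod_sievePrimes_dvd ht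
        have hD0 : ((∏ l ∈ t, l : ℕ) : ℝ) ≠ 0 :=
          Nat.cast_ne_zero.2 (Nat.pos_of_dvd_of_pos hd hq).ne'
        obtain ⟨r, hr⟩ := exists_sum_filter_dvd_eq hq hd (gcd_prod_sievePrimes ht) a
        generalize hDdef : ∏ l ∈ t, l = D at *
        rw [hr]
        have hterm : ∀ m : ℕ, unitExp (-(n * (((r + D * m : ℕ) + θ) / q))) =
            unitExp (-(n * ((r + θ) / q))) * unitExp (-(n / ((q / D : ℕ) : ℝ))) ^ m := by
          intro m
          rw [← unitExp_nat_mul, ← unitExp_add, Nat.cast_div hd hD0]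
          congr 1
          push_cast
          field_simp
          ring
        simp_rw [hterm]
        rw [← Finset.mul_sum, norm_mul, norm_mul, norm_unitExp, norm_pow, norm_neg, norm_one,
          one_pow, one_mul, one_mul]
        exact norm_sum_range_unitExp_le
          (Nat.div_pos (Nat.le_of_dvd hq hd) (Nat.pos_of_dvd_of_pos hd hq)) n
    _ = ∑ D ∈ (sievePrimes q b).powerset.image (fun t => ∏ l ∈ t, l),
        (if ((q / D : ℕ) : ℤ) ∣ n then ((q / D : ℕ) : ℝ) else 0) := by
        rw [Finset.sum_image (prod_injOn_powerset_sievePrimes q b)]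
    _ ≤ ∑ D ∈ q.divisors, (if ((q / D : ℕ) : ℤ) ∣ n then ((q / D : ℕ) : ℝ) else 0) := by
        refine Finset.sum_le_sum_of_subset_of_nonneg ?_ fun D _ _ => by split_ifs <;> positivity
        intro D hD
        obtain ⟨t, ht, rfl⟩ := Finset.mem_image.1 hD
        exact Nat.mem_divisors.2 ⟨prod_sievePrimes_dvd (Finset.mem_powerset.1 ht), hq.ne'⟩
    _ = _ := by
        rw [Nat.sum_div_divisors q fun d => if (d : ℤ) ∣ n then (d : ℝ) else 0, Finset.sum_filter]

lemma exists_card_divisors_le_rpow {ε : ℝ} (hε : 0 < ε) :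
    ∃ K : ℝ, 0 < K ∧ ∀ n : ℕ, 0 < n → (n.divisors.card : ℝ) ≤ K * (n : ℝ) ^ ε := by
  -- Primes `p ≥ P` satisfy `p ^ ε ≥ 2`, so `k + 1 ≤ 2 ^ k` suffices for them. Each of the at most
  -- `P` smaller primes costs a factor `c`.
  obtain ⟨P, hP⟩ := exists_nat_gt ((2 : ℝ) ^ (1 / ε))
  set c : ℝ := max 1 (2 / (ε * Real.log 2)) with hc
  have hc1 : 1 ≤ c := le_max_left _ _
  have hlog2 : 0 < Real.log 2 := Real.log_pos (by norm_num)
  have hbig : ∀ p : ℕ, P ≤ p → ∀ k : ℕ, (k + 1 : ℝ) ≤ (p : ℝ) ^ (k * ε) := by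
    intro p hp k
    have h1 : (2 : ℝ) ≤ (p : ℝ) ^ ε := by
      have h2 : (2 : ℝ) ^ (1 / ε) ≤ p := hP.le.trans (by exact_mod_cast hp)
      calc (2 : ℝ) = ((2 : ℝ) ^ (1 / ε)) ^ ε := by
            rw [← Real.rpow_mul (by norm_num), one_div_mul_cancel hε.ne', Real.rpow_one]
        _ ≤ _ := Real.rpow_le_rpow (by positivity) h2 hε.le
    calc (k + 1 : ℝ) ≤ (2 : ℝ) ^ k := by exact_mod_cast Nat.lt_two_pow_self
      _ ≤ ((p : ℝ) ^ ε) ^ k := by gcongr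
      _ = _ := by rw [← Real.rpow_natCast, ← Real.rpow_mul (by positivity), mul_comm]
  have hsmall : ∀ p : ℕ, 2 ≤ p → ∀ k : ℕ, (k + 1 : ℝ) ≤ c * (p : ℝ) ^ (k * ε) := by
    intro p hp k
    have hp2 : (2 : ℝ) ≤ p := by exact_mod_cast hp
    have h0 : (2 : ℝ) ^ (k * ε) ≤ (p : ℝ) ^ (k * ε) :=
      Real.rpow_le_rpow (by norm_num) hp2 (by positivity)
    have h1 : k * ε * Real.log 2 + 1 ≤ (2 : ℝ) ^ (k * ε) := by
      rw [Real.rpow_def_of_pos (by norm_num)]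
      have := Real.add_one_le_exp (Real.log 2 * (k * ε))
      linarith
    have h3 : 2 ≤ c * (ε * Real.log 2) := by
      have := le_max_right 1 (2 / (ε * Real.log 2))
      rw [← hc, div_le_iff₀ (by positivity)] at this
      exact this
    calc (k + 1 : ℝ) ≤ c * (k * ε * Real.log 2 + 1) := by
          have : (k : ℝ) * 2 ≤ k * (c * (ε * Real.log 2)) := by gcongr
          nlinarith [(Nat.cast_nonneg k : (0 : ℝ) ≤ k)]
      _ ≤ _ := by
          have : (0 : ℝ) ≤ c := by linarith
          gcongr
          exact h1.trans h0
  refine ⟨c ^ P, by positivity, fun n hn => ?_⟩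
  have hn' : (n : ℝ) ^ ε = ∏ p ∈ n.primeFactors, (p : ℝ) ^ (n.factorization p * ε) := by
    conv_lhs => rw [← Nat.prod_factorization_pow_eq_self hn.ne']
    rw [Finsupp.prod, Nat.support_factorization, Nat.cast_prod,
      ← Real.finsetProd_rpow _ _ fun _ _ => by positivity]
    refine Finset.prod_congr rfl fun p _ => ?_
    rw [Nat.cast_pow, ← Real.rpow_natCast, ← Real.rpow_mul (by positivity)]
  rw [Nat.card_divisors hn.ne', hn', Nat.cast_prod]
  calc ∏ p ∈ n.primeFactors, ((n.factorization p + 1 : ℕ) : ℝ)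
      ≤ ∏ p ∈ n.primeFactors, ((if p < P then c else 1) * (p : ℝ) ^ (n.factorization p * ε)) := by
        refine Finset.prod_le_prod (fun _ _ => by positivity) fun p hp => ?_
        push_cast
        split_ifs with h
        · exact hsmall p (Nat.prime_of_mem_primeFactors hp).two_le _
        · rw [one_mul]
          exact hbig p (not_lt.1 h) _
    _ ≤ _ := by
        rw [Finset.prod_mul_distrib]
        gcongr
        rw [← Finset.prod_filter, Finset.prod_const]
        apply pow_le_pow_right₀ hc1
        calc _ ≤ (Finset.range P).card := Finset.card_le_card fun p hp => by
              rw [Finset.mem_range]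
              exact (Finset.mem_filter.1 hp).2
          _ = P := Finset.card_range P

/-! ### Tent combs and integration of their Fourier series -/

/-- The sum of periodic tents of half-width `η` around the points `(p + θ) / q` with
`b * p + a` coprime to `q`. -/
noncomputable def tentComb (q : ℕ) (a b : ℤ) (θ η x : ℝ) : ℝ :=
  ∑ p ∈ goodResidues q a b, periodicTent η (x - (p + θ) / q)

lemma continuous_tentComb (q : ℕ) (a b : ℤ) (θ η : ℝ) : Continuous (tentComb q a b θ η) := by
  unfold tentComb
  refine continuous_finsetSum _ fun p _ => ?_
  exact (continuous_periodicTent η).comp (by fun_prop)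

lemma tentComb_nonneg (q : ℕ) (a b : ℤ) (θ : ℝ) {η : ℝ} (hη : 0 < η) (x : ℝ) :
    0 ≤ tentComb q a b θ η x :=
  Finset.sum_nonneg fun _ _ => periodicTent_nonneg hη _

lemma integrable_tentComb (q : ℕ) (a b : ℤ) (θ : ℝ) {η : ℝ} (hη : 0 < η) {μ : Measure ℝ}
    [IsFiniteMeasure μ] : Integrable (tentComb q a b θ η) μ := by
  refine Integrable.of_bound (continuous_tentComb q a b θ η).aestronglyMeasurable
    (∑ p ∈ goodResidues q a b, 1 / η) (ae_of_all _ fun x => ?_)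
  rw [Real.norm_of_nonneg (tentComb_nonneg q a b θ hη x)]
  refine Finset.sum_le_sum fun p _ => ?_
  rw [periodicTent]
  gcongr
  refine max_le zero_le_one ?_
  have : 0 ≤ ‖((x - (p + θ) / q : ℝ) : UnitAddCircle)‖ / η := by positivity
  linarith

lemma hasSum_tentComb (q : ℕ) (a b : ℤ) (θ : ℝ) {η : ℝ} (hη : 0 < η) (hη' : η ≤ 1 / 2) (x : ℝ) :
    HasSum (fun n : ℤ => ((Real.sinc (Real.pi * η * n) ^ 2 : ℝ) : ℂ) * residueSum q a b θ n *
      unitExp (n * x)) (tentComb q a b θ η x : ℂ) := by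
  have h := hasSum_sum fun p (_ : p ∈ goodResidues q a b) =>
    hasSum_periodicTent hη hη' (x - (p + θ) / q)
  convert h using 1
  · ext n
    rw [residueSum, Finset.mul_sum, Finset.sum_mul]
    refine Finset.sum_congr rfl fun p _ => ?_
    rw [mul_assoc, ← unitExp_add]
    congr 2
    ring
  · simp [tentComb]

lemma exists_of_tentComb_ne_zero {q : ℕ} (hq : 0 < q) {a b : ℤ} {θ η x : ℝ} (hη : 0 < η)
    (h : tentComb q a b θ η x ≠ 0) :
    ∃ p : ℤ, |x - (p + θ) / q| < η ∧ Int.gcd (b * p + a) q = 1 := by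
  obtain ⟨p, hp, hne⟩ := Finset.exists_ne_zero_of_sum_ne_zero h
  obtain ⟨m, hm⟩ := exists_int_of_periodicTent_ne_zero hη hne
  have hq0 : (q : ℝ) ≠ 0 := by exact_mod_cast hq.ne'
  refine ⟨p + q * m, ?_, ?_⟩
  · convert hm using 2
    push_cast
    field_simp
    ring
  · have := (Finset.mem_filter.1 hp).2
    rw [← this, show b * (p + q * m) + a = (b * p + a) + q * (b * m) by ring]
    exact Int.gcd_add_mul_left_left ..

lemma le_tentComb {q : ℕ} (hq : 0 < q) {a b : ℤ} {θ δ x : ℝ} (hδ : 0 < δ) {p : ℤ}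
    (hp : Int.gcd (b * p + a) q = 1) (hx : |x - (p + θ) / q| ≤ δ) :
    1 / (4 * δ) ≤ tentComb q a b θ (2 * δ) x := by
  have hq0 : (q : ℝ) ≠ 0 := by exact_mod_cast hq.ne'
  have hqZ : (0 : ℤ) < q := by exact_mod_cast hq
  set r : ℕ := (p % q).toNat with hr
  have hrZ : (r : ℤ) = p % q := Int.toNat_of_nonneg (Int.emod_nonneg _ hqZ.ne')
  have hpr : p = r + q * (p / q) := by
    rw [hrZ, Int.emod_add_mul_ediv]
  have hmem : r ∈ goodResidues q a b := by
    refine Finset.mem_filter.2 ⟨Finset.mem_range.2 ?_, ?_⟩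
    · have := Int.emod_lt_of_pos p hqZ
      omega
    · rw [← hp]
      conv_rhs => rw [hpr, show b * (r + q * (p / q)) + a = (b * r + a) + q * (b * (p / q)) by ring]
      exact (Int.gcd_add_mul_left_left ..).symm
  calc 1 / (4 * δ) ≤ periodicTent (2 * δ) (x - (p + θ) / q) := le_periodicTent hδ hx
    _ = periodicTent (2 * δ) (x - (r + θ) / q) := by
        rw [← periodicTent_sub_intCast _ (x - (r + θ) / q) (p / q)]
        congr 1
        have : (p : ℝ) = r + q * ((p / q : ℤ) : ℝ) := by exact_mod_cast hpr
        rw [this]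
        field_simp
        ring
    _ ≤ _ := Finset.single_le_sum (f := fun r : ℕ => periodicTent (2 * δ) (x - (r + θ) / q))
        (fun _ _ => periodicTent_nonneg (by positivity) _) hmem

lemma hasSum_integral_unitExp {μ : Measure ℝ} {c : ℤ → ℂ} (hc : Summable fun n => ‖c n‖)
    {F : ℝ → ℂ} (hF : ∀ x, HasSum (fun n : ℤ => c n * unitExp (n * x)) (F x))
    {g : ℝ → ℂ} (hg : Integrable g μ) :
    HasSum (fun n : ℤ => c n * ∫ x, unitExp (n * x) * g x ∂μ) (∫ x, F x * g x ∂μ) := by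
  have hint : ∀ n : ℤ, Integrable (fun x => c n * (unitExp (n * x) * g x)) μ := by
    intro n
    refine Integrable.const_mul ?_ _
    refine hg.bdd_mul (c := 1) ?_ ?_
    · exact (continuous_unitExp.comp (by fun_prop)).aestronglyMeasurable
    · exact ae_of_all _ fun x => (norm_unitExp _).le
  have hnorm : ∀ (n : ℤ) x, ‖c n * (unitExp (n * x) * g x)‖ = ‖c n‖ * ‖g x‖ := by
    intro n x
    rw [norm_mul, norm_mul, norm_unitExp, one_mul]
  have h := hasSum_integral_of_summable_integral_norm hint (by
    simp_rw [hnorm, integral_const_mul]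
    exact hc.mul_right _)
  have e1 : ∀ n : ℤ, c n * ∫ x, unitExp (n * x) * g x ∂μ =
      ∫ x, c n * (unitExp (n * x) * g x) ∂μ := fun n => (integral_const_mul _ _).symm
  have e2 : ∀ x, F x * g x = ∑' n : ℤ, c n * (unitExp (n * x) * g x) := by
    intro x
    rw [← ((hF x).mul_right (g x)).tsum_eq]
    congr 1
    ext n
    ring
  simp_rw [e1, e2]
  exact h

/-! ### The upper bound -/

/-- A decreasing integrable weight on the positive half-line. -/
noncomputable def decayWeight (u : ℝ) : ℝ := 1 / (√u * (1 + √u) ^ 2)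

lemma decayWeight_nonneg (u : ℝ) : 0 ≤ decayWeight u := by
  unfold decayWeight
  positivity

lemma decayWeight_zero : decayWeight 0 = 0 := by simp [decayWeight]

/-- The weight is the derivative of `2 √u / (1 + √u)`, which increases from `0` to a limit of `2`.
The right-endpoint Riemann sum of a decreasing function is therefore bounded by a telescoping sum,
uniformly in the step `y`. -/
lemma sum_range_decayWeight_le {y : ℝ} (hy : 0 < y) (M : ℕ) :
    ∑ m ∈ Finset.range M, y * decayWeight (y * (m + 1 : ℕ)) ≤ 2 := by
  have hstep : ∀ m : ℕ, y * decayWeight (y * (m + 1 : ℕ)) ≤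
      2 * (√(y * (m + 1 : ℕ)) / (1 + √(y * (m + 1 : ℕ)))) - 2 * (√(y * m) / (1 + √(y * m))) := by
    intro m
    have hv0 : 0 ≤ √(y * m) := Real.sqrt_nonneg _
    have hu0 : 0 < √(y * (m + 1 : ℕ)) := Real.sqrt_pos.2 (by positivity)
    have huv : √(y * m) ≤ √(y * (m + 1 : ℕ)) := Real.sqrt_le_sqrt (by push_cast; nlinarith)
    have hu2 : √(y * (m + 1 : ℕ)) ^ 2 = y * (m + 1 : ℕ) := Real.sq_sqrt (by positivity)
    have hv2 : √(y * m) ^ 2 = y * m := Real.sq_sqrt (by positivity)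
    have hy' : y = √(y * (m + 1 : ℕ)) ^ 2 - √(y * m) ^ 2 := by
      rw [hu2, hv2]
      push_cast
      ring
    rw [decayWeight]
    generalize √(y * (m + 1 : ℕ)) = u at *
    generalize √(y * m) = v at *
    rw [hy']
    calc (u ^ 2 - v ^ 2) * (1 / (u * (1 + u) ^ 2)) ≤ (2 * u * (u - v)) * (1 / (u * (1 + u) ^ 2)) := by
          gcongr
          nlinarith
      _ = 2 * (u - v) / ((1 + u) * (1 + u)) := by
          field_simp
      _ ≤ 2 * (u - v) / ((1 + u) * (1 + v)) := by
          have : 0 ≤ 2 * (u - v) := by linarith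
          gcongr
      _ = _ := by
          field_simp
          ring
  refine (Finset.sum_le_sum fun m _ => hstep m).trans ?_
  rw [Finset.sum_range_sub (fun m : ℕ => 2 * (√(y * m) / (1 + √(y * m))))]
  simp only [Nat.cast_zero, mul_zero, Real.sqrt_zero, zero_div, sub_zero]
  have : √(y * M) / (1 + √(y * M)) ≤ 1 := by
    rw [div_le_one (by positivity)]
    linarith
  linarith

lemma exists_hasSum_decayWeight {y : ℝ} (hy : 0 < y) :
    ∃ S ≤ 4, HasSum (fun m : ℤ => y * decayWeight (y * |(m : ℝ)|)) S := by
  have hnn : ∀ m : ℕ, 0 ≤ y * decayWeight (y * (m + 1 : ℕ)) := fun m =>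
    mul_nonneg hy.le (decayWeight_nonneg _)
  have hsum := summable_of_sum_range_le hnn (sum_range_decayWeight_le hy)
  have hle := hsum.tsum_le_of_sum_range_le (sum_range_decayWeight_le hy)
  set f : ℤ → ℝ := fun m => y * decayWeight (y * |(m : ℝ)|) with hf
  have h1 : HasSum (fun m : ℕ => f m) (∑' m : ℕ, y * decayWeight (y * (m + 1 : ℕ))) := by
    have e : ∀ m : ℕ, f m = y * decayWeight (y * m) := by
      intro m
      simp [hf]
    simp_rw [e]
    have := HasSum.zero_add (f := fun m : ℕ => y * decayWeight (y * m)) hsum.hasSum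
    simpa [decayWeight_zero] using this
  have h2 : HasSum (fun m : ℕ => f (-(m + 1 : ℤ))) (∑' m : ℕ, y * decayWeight (y * (m + 1 : ℕ))) := by
    convert hsum.hasSum using 1
    ext m
    simp only [hf]
    congr 3
    push_cast
    rw [abs_neg, abs_of_nonneg (by positivity)]
  refine ⟨_, ?_, HasSum.of_nat_of_neg_add_one h1 h2⟩
  linarith

lemma exists_hasSum_decayWeight_multiples {δ : ℝ} (hδ : 0 < δ) {d : ℕ} (hd : 0 < d) :
    ∃ S ≤ 4, HasSum (fun n : ℤ => if (d : ℤ) ∣ n then δ * d * decayWeight (δ * |(n : ℝ)|) else 0)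
      S := by
  have hd0 : (0 : ℝ) < d := by exact_mod_cast hd
  obtain ⟨S, hS, h⟩ := exists_hasSum_decayWeight (y := δ * d) (by positivity)
  refine ⟨S, hS, ?_⟩
  have hinj : Function.Injective fun m : ℤ => (d : ℤ) * m :=
    mul_right_injective₀ (by exact_mod_cast hd.ne')
  rw [← hinj.hasSum_iff]
  · convert h using 1
    ext m
    simp [abs_mul]
    left
    ring_nf
  · intro n hn
    rw [if_neg]
    rintro ⟨m, rfl⟩
    exact hn ⟨m, rfl⟩

/-- One weight dominates all exponents `α ≤ 1/2`: it is comparable to `u ^ (-1/2)` near zero, and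
the squared `sinc` takes over for `u ≥ 1`. -/
lemma sinc_sq_mul_rpow_le {u α : ℝ} (hu : 0 < u) (h0 : 0 ≤ α) (h1 : α ≤ 1 / 2) :
    Real.sinc (2 * Real.pi * u) ^ 2 * u ^ (-α) ≤ 4 * decayWeight u := by
  have hs : 0 < √u := Real.sqrt_pos.2 hu
  have hs2 : √u ^ 2 = u := Real.sq_sqrt hu.le
  rw [decayWeight]
  rcases le_total u 1 with h | h
  · have hsl : √u ≤ 1 := Real.sqrt_le_one.2 h
    have hr : u ^ (-α) ≤ u ^ (-(1 / 2) : ℝ) :=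
      Real.rpow_le_rpow_of_exponent_ge hu h (by linarith)
    calc Real.sinc (2 * Real.pi * u) ^ 2 * u ^ (-α) ≤ 1 * u ^ (-(1 / 2) : ℝ) :=
          mul_le_mul (sinc_sq_le_one _) hr (by positivity) zero_le_one
      _ = 4 * (1 / (√u * (1 + 1) ^ 2)) := by
          rw [Real.rpow_neg hu.le, ← Real.sqrt_eq_rpow]
          field_simp
          norm_num
      _ ≤ _ := by gcongr
  · have hsl : 1 ≤ √u := Real.one_le_sqrt.2 h
    have hpi := Real.pi_gt_three
    calc Real.sinc (2 * Real.pi * u) ^ 2 * u ^ (-α) ≤ (1 / (2 * Real.pi * u) ^ 2) * 1 := by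
          gcongr
          · exact sinc_sq_le_inv_sq (by positivity)
          · exact Real.rpow_le_one_of_one_le_of_nonpos h (by linarith)
      _ ≤ 1 / u ^ 2 := by
          rw [mul_one]
          gcongr
          nlinarith
      _ = 4 * (1 / (4 * u ^ 2)) := by
          field_simp
      _ ≤ _ := by
          have : √u * (1 + √u) ^ 2 ≤ 4 * u ^ 2 :=
            calc √u * (1 + √u) ^ 2 ≤ √u ^ 2 * (√u + √u) ^ 2 := by
                  gcongr
                  nlinarith
              _ = 4 * (√u ^ 2) ^ 2 := by ring
              _ = 4 * u ^ 2 := by rw [hs2]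
          exact mul_le_mul_of_nonneg_left (one_div_le_one_div_of_le (by positivity) this)
            (by norm_num)

lemma summable_norm_tentComb_coeff (q : ℕ) (a b : ℤ) (θ : ℝ) {η : ℝ} (hη : 0 < η)
    (hη' : η ≤ 1 / 2) : Summable fun n : ℤ =>
      ‖((Real.sinc (Real.pi * η * n) ^ 2 : ℝ) : ℂ) * residueSum q a b θ n‖ := by
  have := (hasSum_tentComb q a b θ hη hη' 0).summable.norm
  simpa [unitExp_zero] using this

lemma measureFourier_zero (ν : Measure ℝ) [IsProbabilityMeasure ν] : measureFourier ν 0 = 1 := by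
  simp [measureFourier]

/-- The zero frequency gives the main term. For the others, `(1 + |n|) ^ (-α) ≤ δ ^ α (δ |n|) ^
(-α)`, and each divisor `d` of `q` contributes a sum over the multiples of `d` that is bounded
independently of `d` and `δ`. -/
lemma integral_tentComb_le {α C : ℝ} (h0 : 0 ≤ α) (h1 : α ≤ 1 / 2) (hC : 0 ≤ C)
    {ν : Measure ℝ} [IsProbabilityMeasure ν]
    (hν : ∀ ξ : ℝ, ‖measureFourier ν ξ‖ ≤ C * (1 + |ξ|) ^ (-α))
    {q : ℕ} (hq : 0 < q) {a b : ℤ} (hab : Int.gcd a b = 1) (θ : ℝ) {δ : ℝ} (hδ : 0 < δ)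
    (hδ' : δ ≤ 1 / 4) :
    δ * ∫ x, tentComb q a b θ (2 * δ) x ∂ν ≤
      δ * (goodResidues q a b).card + 16 * C * q.divisors.card * δ ^ α := by
  have hη : 0 < 2 * δ := by positivity
  have hη' : 2 * δ ≤ 1 / 2 := by linarith
  have hsum := (hasSum_integral_unitExp (summable_norm_tentComb_coeff q a b θ hη hη')
    (hasSum_tentComb q a b θ hη hη') (integrable_const (μ := ν) (1 : ℂ))).mul_left (δ : ℂ)
  simp only [mul_one] at hsum
  rw [integral_complex_ofReal] at hsum
  have hdiv : ∀ d : q.divisors, ∃ S ≤ 4, HasSum (fun n : ℤ =>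
      if ((d : ℕ) : ℤ) ∣ n then δ * (d : ℕ) * decayWeight (δ * |(n : ℝ)|) else 0) S := fun d =>
    exists_hasSum_decayWeight_multiples hδ (Nat.pos_of_mem_divisors d.2)
  choose S hS4 hS using hdiv
  have hbound := (hasSum_ite_eq (0 : ℤ) (δ * (goodResidues q a b).card : ℝ)).add
    ((hasSum_sum fun d (_ : d ∈ Finset.univ) => hS d).mul_left (4 * C * δ ^ α))
  have hle := hsum.norm_le_of_bounded hbound ?_
  · have hcard : ∑ d : q.divisors, S d ≤ 4 * q.divisors.card := by
      calc ∑ d : q.divisors, S d ≤ ∑ d : q.divisors, (4 : ℝ) := Finset.sum_le_sum fun d _ => hS4 d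
        _ = _ := by simp [mul_comm]
    rw [← Complex.ofReal_mul, Complex.norm_real] at hle
    refine (le_abs_self _).trans (hle.trans ?_)
    have : 4 * C * δ ^ α * ∑ d : q.divisors, S d ≤ 4 * C * δ ^ α * (4 * q.divisors.card) := by
      gcongr
    linarith
  · intro n
    have hnnS : 0 ≤ ∑ d : q.divisors,
        (if ((d : ℕ) : ℤ) ∣ n then δ * (d : ℕ) * decayWeight (δ * |(n : ℝ)|) else 0) := by
      refine Finset.sum_nonneg fun d _ => ?_
      have := decayWeight_nonneg (δ * |(n : ℝ)|)
      split_ifs <;> positivity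
    have hfour : ∫ x, unitExp (n * x) ∂ν = measureFourier ν (-n) := by
      rw [measureFourier_eq]
      simp
    rw [hfour, norm_mul, norm_mul, norm_mul, Complex.norm_real, Complex.norm_real,
      Real.norm_of_nonneg hδ.le, Real.norm_of_nonneg (sq_nonneg _)]
    by_cases hn : n = 0
    · rw [if_pos hn]
      subst hn
      rw [residueSum_zero]
      simp only [Int.cast_zero, mul_zero, Real.sinc_zero, neg_zero, measureFourier_zero]
      simp [decayWeight_zero]
    · rw [if_neg hn, zero_add]
      have hn0 : 0 < |(n : ℝ)| := abs_pos.2 (by exact_mod_cast hn)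
      have hm : ‖measureFourier ν (-n)‖ ≤ C * (δ ^ α * (δ * |(n : ℝ)|) ^ (-α)) := by
        refine (hν _).trans ?_
        rw [abs_neg, Real.mul_rpow hδ.le hn0.le, ← mul_assoc (δ ^ α), ← Real.rpow_add hδ,
          add_neg_cancel, Real.rpow_zero, one_mul]
        refine mul_le_mul_of_nonneg_left ?_ hC
        exact Real.rpow_le_rpow_of_nonpos hn0 (by linarith) (by linarith)
      have hsinc : Real.sinc (Real.pi * (2 * δ) * n) ^ 2 =
          Real.sinc (2 * Real.pi * (δ * |(n : ℝ)|)) ^ 2 := by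
        rcases abs_choice (n : ℝ) with h | h
        · rw [h]
          ring_nf
        · rw [h, ← Real.sinc_neg]
          ring_nf
      have hw := sinc_sq_mul_rpow_le (u := δ * |(n : ℝ)|) (by positivity) h0 h1
      have hR := norm_residueSum_le hq hab θ n
      rw [hsinc]
      calc _ ≤ δ * (Real.sinc (2 * Real.pi * (δ * |(n : ℝ)|)) ^ 2 *
            (∑ d ∈ q.divisors.filter (fun d : ℕ => (d : ℤ) ∣ n), (d : ℝ)) *
            (C * (δ ^ α * (δ * |(n : ℝ)|) ^ (-α)))) := by
            gcongr
        _ = C * δ ^ α * δ * (∑ d ∈ q.divisors.filter (fun d : ℕ => (d : ℤ) ∣ n), (d : ℝ)) *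
            (Real.sinc (2 * Real.pi * (δ * |(n : ℝ)|)) ^ 2 * (δ * |(n : ℝ)|) ^ (-α)) := by
            ring
        _ ≤ C * δ ^ α * δ * (∑ d ∈ q.divisors.filter (fun d : ℕ => (d : ℤ) ∣ n), (d : ℝ)) *
            (4 * decayWeight (δ * |(n : ℝ)|)) := by
            gcongr
        _ = _ := by
            rw [Finset.sum_coe_sort q.divisors (fun d : ℕ => if (d : ℤ) ∣ n then
              δ * d * decayWeight (δ * |(n : ℝ)|) else 0), ← Finset.sum_filter,
              ← Finset.sum_mul, ← Finset.mul_sum]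
            ring

/-- The points within distance `δ` of some `(p + θ) / q` with `b * p + a` coprime to `q`. -/
def approxBand (q : ℕ) (a b : ℤ) (θ δ : ℝ) : Set ℝ :=
  {x | ∃ p : ℤ, |x - (p + θ) / q| < δ ∧ Int.gcd (b * p + a) q = 1}

lemma measureReal_approxBand_le {α C : ℝ} (h0 : 0 ≤ α) (h1 : α ≤ 1 / 2) (hC : 1 ≤ C)
    {ν : Measure ℝ} [IsProbabilityMeasure ν]
    (hν : ∀ ξ : ℝ, ‖measureFourier ν ξ‖ ≤ C * (1 + |ξ|) ^ (-α))
    {q : ℕ} (hq : 0 < q) {a b : ℤ} (hab : Int.gcd a b = 1) (θ : ℝ) {ψ : ℝ} (hψ : 0 ≤ ψ) :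
    ν.real (approxBand q a b θ (ψ / q)) ≤
      4 * (ψ * coprimeDensity q b) + 64 * C * (q.divisors.card * (ψ / q) ^ α) := by
  have hq0 : (0 : ℝ) < q := by exact_mod_cast hq
  have hcd : 0 ≤ coprimeDensity q b :=
    le_trans (by positivity) (inv_card_divisors_le_coprimeDensity hq b)
  rcases hψ.eq_or_lt with rfl | hψ0
  · have : approxBand q a b θ (0 / q) = ∅ := by
      ext x
      simp only [approxBand, mem_ofPred_eq, zero_div, mem_empty_iff_false, iff_false]
      rintro ⟨p, hp, -⟩
      exact (abs_nonneg _).not_gt hp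
    rw [this]
    simp only [measureReal_empty]
    positivity
  have hδ : 0 < ψ / q := by positivity
  rcases le_total (ψ / q) (1 / 4) with hle | hge
  · have hM := mul_meas_ge_le_integral_of_nonneg (μ := ν) (f := tentComb q a b θ (2 * (ψ / q)))
      (ae_of_all _ fun x => tentComb_nonneg q a b θ (by positivity) x) ?_ (1 / (4 * (ψ / q)))
    · have hsub : approxBand q a b θ (ψ / q) ⊆
          {x | 1 / (4 * (ψ / q)) ≤ tentComb q a b θ (2 * (ψ / q)) x} := by
        rintro x ⟨p, hp, hg⟩
        exact le_tentComb hq hδ hg hp.le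
      have h2 : ν.real (approxBand q a b θ (ψ / q)) ≤
          4 * (ψ / q * ∫ x, tentComb q a b θ (2 * (ψ / q)) x ∂ν) := by
        refine (measureReal_mono hsub).trans ?_
        rw [one_div_mul_eq_div, div_le_iff₀ (by positivity)] at hM
        linarith
      have h3 := integral_tentComb_le h0 h1 (by linarith) hν hq hab θ hδ hle
      rw [card_goodResidues hq hab] at h3
      have h4 : ψ / q * (q * coprimeDensity q b) = ψ * coprimeDensity q b := by
        field_simp
      rw [h4] at h3
      linarith
    · exact integrable_tentComb q a b θ (by positivity)
  -- For wide bands the error term alone already exceeds the total mass one.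
  · have h5 : (1 / 2 : ℝ) ≤ (ψ / q) ^ α := by
      calc (1 / 2 : ℝ) = (1 / 4) ^ (1 / 2 : ℝ) := by
            rw [← Real.sqrt_eq_rpow]
            rw [show (1 / 4 : ℝ) = (1 / 2) ^ 2 by norm_num, Real.sqrt_sq (by norm_num)]
        _ ≤ (1 / 4) ^ α := Real.rpow_le_rpow_of_exponent_ge (by norm_num) (by norm_num) h1
        _ ≤ _ := Real.rpow_le_rpow (by norm_num) hge h0
    have h6 : (1 : ℝ) ≤ q.divisors.card := by
      exact_mod_cast Finset.card_pos.2 ⟨1, Nat.one_mem_divisors.2 hq.ne'⟩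
    have h7 : (1 / 2 : ℝ) ≤ q.divisors.card * (ψ / q) ^ α := by nlinarith
    have h8 : ν.real (approxBand q a b θ (ψ / q)) ≤ 1 := measureReal_le_one
    have h9 : 0 ≤ ψ * coprimeDensity q b := by positivity
    nlinarith

lemma finite_int_abs_sub_lt (y z ρ : ℝ) {c : ℝ} (hc : 0 < c) :
    {p : ℤ | |y - (p + z) / c| < ρ}.Finite := by
  refine (Set.finite_Icc ⌊c * y - z - c * ρ⌋ ⌈c * y - z + c * ρ⌉).subset fun p hp => ?_
  obtain ⟨h1, h2⟩ := abs_lt.1 (show |y - (p + z) / c| < ρ from hp)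
  have e : (p : ℝ) = c * ((p + z) / c) - z := by
    field_simp
    ring
  constructor
  · have : (⌊c * y - z - c * ρ⌋ : ℝ) ≤ p := (Int.floor_le _).trans (by rw [e]; nlinarith)
    exact_mod_cast this
  · have : (p : ℝ) ≤ ⌈c * y - z + c * ρ⌉ := le_trans (by rw [e]; nlinarith) (Int.le_ceil _)
    exact_mod_cast this

lemma infinite_setOf_mem_approxBand {Q : Set ℕ} (hQ : ∀ q ∈ Q, 0 < q) {A B : ℕ → ℤ}
    {ψ θ : Q → ℝ} {x : ℝ} (hx : x ∈ approxSet Q ψ θ A B) :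
    {q : Q | x ∈ approxBand q (A q) (B q) (θ q) (ψ q / (q : ℕ))}.Infinite := by
  intro hfin
  refine hx.2 ((hfin.biUnion fun q _ => (finite_int_abs_sub_lt x (θ q) (ψ q / (q : ℕ))
    (c := ((q : ℕ) : ℝ)) (by exact_mod_cast hQ q q.2)).image fun p => (p, q)).subset ?_)
  rintro ⟨p, q⟩ ⟨h1, h2⟩
  simp only [mem_iUnion]
  exact ⟨q, ⟨p, h1, h2⟩, p, h1, rfl⟩

lemma fourierDim_exponent_le {Q : Set ℕ} (hQ : ∀ q ∈ Q, 0 < q) {A B : ℕ → ℤ}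
    (hAB : ∀ q ∈ Q, Int.gcd (A q) (B q) = 1) {ψ θ : Q → ℝ} (hψ : ∀ q : Q, 0 ≤ ψ q ∧ ψ q < 1 / 2)
    (hconv : Summable fun q : Q => ψ q * coprimeDensity q (B q)) {s : ℝ} (hs : s ∈ Icc (0 : ℝ) 1)
    {ν : Measure ℝ} [IsProbabilityMeasure ν] (hνE : ν (approxSet Q ψ θ A B)ᶜ = 0)
    {C : ℝ} (hC : ∀ ξ : ℝ, ‖measureFourier ν ξ‖ ≤ C * (1 + |ξ|) ^ (-s / 2)) :
    s ≤ 2 * convExponent Q ψ := by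
  by_contra! hlt
  have hC1 : 1 ≤ C := by simpa [measureFourier_zero] using hC 0
  rw [neg_div] at hC
  have hne : {t : ℝ | 0 ≤ t ∧ Summable fun q : Q => (ψ q / ((q : ℕ) : ℝ)) ^ t}.Nonempty := by
    -- The exponent `2` is admissible because `ψ q / q < 1 / q`. Nonemptiness excludes the default
    -- value of `sInf ∅`.
    refine ⟨2, by norm_num, ?_⟩
    refine Summable.of_nonneg_of_le (fun q => ?_) (fun q => ?_)
      ((Real.summable_one_div_nat_pow.2 one_lt_two).comp_injective Subtype.val_injective)
    · exact Real.rpow_nonneg (div_nonneg (hψ q).1 (Nat.cast_nonneg _)) _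
    · have hq0 : (0 : ℝ) < (q : ℕ) := by exact_mod_cast hQ q q.2
      have := (hψ q).1
      rw [Real.rpow_two, Function.comp_apply, ← one_div_pow]
      gcongr
      linarith [(hψ q).2]
  obtain ⟨t, ⟨ht0, ht⟩, hts⟩ := exists_lt_of_csInf_lt hne
    (show convExponent Q ψ < s / 2 by linarith)
  -- With this exponent the divisor loss `q ^ (s/2 - t)` is absorbed by `(ψ q / q) ^ (s/2 - t)`,
  -- because `ψ q ≤ 1`.
  obtain ⟨K, hK0, hK⟩ := exists_card_divisors_le_rpow (ε := s / 2 - t) (by linarith)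
  have hdiv : ∀ q : Q, ((q : ℕ).divisors.card : ℝ) * (ψ q / (q : ℕ)) ^ (s / 2) ≤
      K * (ψ q / (q : ℕ)) ^ t := by
    intro q
    have hq0 : (0 : ℝ) < (q : ℕ) := by exact_mod_cast hQ q q.2
    rcases (hψ q).1.eq_or_lt with h | h
    · rw [← h, zero_div, Real.zero_rpow (by linarith), mul_zero]
      positivity
    · have hδ : 0 < ψ q / (q : ℕ) := by positivity
      have e : s / 2 = (s / 2 - t) + t := by ring
      rw [e, Real.rpow_add hδ, ← mul_assoc]
      refine mul_le_mul_of_nonneg_right ?_ (by positivity)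
      calc _ ≤ K * ((q : ℕ) : ℝ) ^ (s / 2 - t) * (ψ q / (q : ℕ)) ^ (s / 2 - t) := by
            gcongr
            exact hK q (hQ q q.2)
        _ = K * (ψ q) ^ (s / 2 - t) := by
            rw [mul_assoc, ← Real.mul_rpow hq0.le hδ.le]
            congr 2
            field_simp
        _ ≤ K * 1 := by
            gcongr
            exact Real.rpow_le_one h.le (by linarith [(hψ q).2]) (by linarith)
        _ = K := mul_one K
  have hbound : ∀ q : Q, ν (approxBand q (A q) (B q) (θ q) (ψ q / (q : ℕ))) ≤
      ENNReal.ofReal (4 * (ψ q * coprimeDensity q (B q)) +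
        64 * C * (K * (ψ q / (q : ℕ)) ^ t)) := by
    intro q
    rw [← ENNReal.ofReal_toReal (measure_ne_top ν _)]
    apply ENNReal.ofReal_le_ofReal
    refine (measureReal_approxBand_le (by linarith [hs.1]) (by linarith [hs.2]) hC1 hC (hQ q q.2)
      (hAB q q.2) (θ q) (hψ q).1).trans ?_
    have := hdiv q
    gcongr
  have hfin : ∑' q : Q, ν (approxBand q (A q) (B q) (θ q) (ψ q / (q : ℕ))) ≠ ⊤ :=
    ne_top_of_le_ne_top ((hconv.mul_left 4).add ((ht.mul_left K).mul_left (64 * C))).tsum_ofReal_ne_top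
      (ENNReal.tsum_le_tsum hbound)
  have hae := ae_finite_setOfPred_mem hfin
  have hae2 : ∀ᵐ x ∂ν, x ∈ approxSet Q ψ θ A B := hνE
  obtain ⟨x, hx1, hx2⟩ := (hae.and hae2).exists
  exact infinite_setOf_mem_approxBand hQ hx2 hx1

/-! ### Smooth densities, multipliers and weak limits -/

section

open Filter Topology

/-- The Fourier transform of the density `H`. -/
noncomputable def densityFourier (H : ℝ → ℝ) (ξ : ℝ) : ℂ := ∫ x, unitExp (-(ξ * x)) * (H x : ℂ)

/-- A continuous nonnegative density supported in the unit interval with quadratically decaying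
Fourier transform. -/
structure IsDecayDensity (H : ℝ → ℝ) : Prop where
  continuous : Continuous H
  nonneg : ∀ x, 0 ≤ H x
  eq_zero : ∀ x, x ∉ Icc (0 : ℝ) 1 → H x = 0
  decay : ∃ C : ℝ, ∀ ξ, ‖densityFourier H ξ‖ ≤ C * (1 + |ξ|) ^ (-2 : ℝ)

/-- A continuous nonnegative `1`-periodic function with integral one, whose Fourier coefficients
`c n` decay quadratically and are bounded by `ε * (1 + |n|) ^ (-s)` for nonzero `n`. -/
structure IsMultiplier (s ε : ℝ) (F : ℝ → ℝ) (c : ℤ → ℂ) : Prop where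
  continuous : Continuous F
  nonneg : ∀ x, 0 ≤ F x
  hasSum : ∀ x, HasSum (fun n : ℤ => c n * unitExp (n * x)) (F x : ℂ)
  coeff_zero : c 0 = 1
  decay_two : ∃ C : ℝ, ∀ n : ℤ, ‖c n‖ ≤ C * (1 + |(n : ℝ)|) ^ (-2 : ℝ)
  decay : ∀ n : ℤ, n ≠ 0 → ‖c n‖ ≤ ε * (1 + |(n : ℝ)|) ^ (-s)

lemma IsDecayDensity.hasCompactSupport {H : ℝ → ℝ} (hH : IsDecayDensity H) :
    HasCompactSupport H :=
  HasCompactSupport.intro isCompact_Icc hH.eq_zero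

lemma IsDecayDensity.integrable {H : ℝ → ℝ} (hH : IsDecayDensity H) : Integrable H :=
  hH.continuous.integrable_of_hasCompactSupport hH.hasCompactSupport

lemma IsDecayDensity.integrable_unitExp_mul {H : ℝ → ℝ} (hH : IsDecayDensity H) (ξ : ℝ) :
    Integrable fun x => unitExp (-(ξ * x)) * (H x : ℂ) := by
  refine hH.integrable.ofReal.bdd_mul (c := 1) ?_ (ae_of_all _ fun x => (norm_unitExp _).le)
  exact (continuous_unitExp.comp (by fun_prop)).aestronglyMeasurable

lemma densityFourier_zero (H : ℝ → ℝ) : densityFourier H 0 = ((∫ x, H x : ℝ) : ℂ) := by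
  simp [densityFourier, unitExp_zero, integral_complex_ofReal]

lemma IsMultiplier.hasSum_densityFourier {s ε : ℝ} {F : ℝ → ℝ} {c : ℤ → ℂ}
    (hF : IsMultiplier s ε F c) {H : ℝ → ℝ} (hH : IsDecayDensity H) (ξ : ℝ) :
    HasSum (fun n : ℤ => c n * densityFourier H (ξ - n))
      (densityFourier (fun x => F x * H x) ξ) := by
  have hc : Summable fun n => ‖c n‖ := by
    have := (hF.hasSum 0).summable.norm
    simpa [unitExp_zero] using this
  have h := hasSum_integral_unitExp hc hF.hasSum (hH.integrable_unitExp_mul ξ)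
  convert h using 1
  · ext n
    rw [densityFourier]
    congr 2
    ext x
    rw [← mul_assoc, ← unitExp_add]
    congr 2
    ring
  · rw [densityFourier]
    congr 1
    ext x
    push_cast
    ring

/-- The bound is uniform in `ξ` because replacing `ξ` by its floor changes `1 + |ξ - n|` by at most
a factor two. The exponent `3/2` is what remains of quadratic decay after a loss of `s ≤ 1/2`. -/
lemma exists_hasSum_shift_rpow_le :
    ∃ K : ℝ, 0 < K ∧ ∀ ξ : ℝ, ∃ S ≤ K, HasSum (fun n : ℤ => (1 + |ξ - n|) ^ (-(3 / 2) : ℝ)) S := by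
  have hbase : Summable fun n : ℤ => (1 + |(n : ℝ)|) ^ (-(3 / 2) : ℝ) := by
    have h1 := (Real.summable_abs_int_rpow (b := 3 / 2) (by norm_num)).add
      (hasSum_ite_eq (0 : ℤ) (1 : ℝ)).summable
    refine Summable.of_nonneg_of_le (fun n => by positivity) (fun n => ?_) h1
    by_cases hn : n = 0
    · simp [hn]
    · rw [if_neg hn, add_zero]
      have hn0 : 0 < |(n : ℝ)| := abs_pos.2 (by exact_mod_cast hn)
      exact Real.rpow_le_rpow_of_nonpos hn0 (by linarith) (by norm_num)
  set B := ∑' n : ℤ, (1 + |(n : ℝ)|) ^ (-(3 / 2) : ℝ) with hB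
  have hB0 : 0 ≤ B := tsum_nonneg fun n => by positivity
  refine ⟨2 ^ (3 / 2 : ℝ) * B + 1, by positivity, fun ξ => ?_⟩
  have hshift : HasSum (fun n : ℤ => 2 ^ (3 / 2 : ℝ) * (1 + |((⌊ξ⌋ - n : ℤ) : ℝ)|) ^ (-(3 / 2) : ℝ))
      (2 ^ (3 / 2 : ℝ) * B) := by
    refine HasSum.mul_left _ ?_
    exact (Equiv.subLeft ⌊ξ⌋).hasSum_iff.2 hbase.hasSum
  have hle : ∀ n : ℤ, (1 + |ξ - n|) ^ (-(3 / 2) : ℝ) ≤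
      2 ^ (3 / 2 : ℝ) * (1 + |((⌊ξ⌋ - n : ℤ) : ℝ)|) ^ (-(3 / 2) : ℝ) := by
    intro n
    have h1 : (1 + |((⌊ξ⌋ - n : ℤ) : ℝ)|) / 2 ≤ 1 + |ξ - n| := by
      push_cast
      have h2 : |(⌊ξ⌋ : ℝ) - n| ≤ |(⌊ξ⌋ : ℝ) - ξ| + |ξ - n| := abs_sub_le _ _ _
      have h3 : |(⌊ξ⌋ : ℝ) - ξ| ≤ 1 := by
        rw [abs_sub_comm, abs_le]
        constructor <;> linarith [Int.floor_le ξ, Int.lt_floor_add_one ξ]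
      linarith [abs_nonneg (ξ - n)]
    calc _ ≤ ((1 + |((⌊ξ⌋ - n : ℤ) : ℝ)|) / 2) ^ (-(3 / 2) : ℝ) :=
          Real.rpow_le_rpow_of_nonpos (by positivity) h1 (by norm_num)
      _ = _ := by
          rw [Real.div_rpow (by positivity) (by norm_num), Real.rpow_neg (by norm_num : (0 : ℝ) ≤ 2)]
          field_simp
  have hs : Summable fun n : ℤ => (1 + |ξ - n|) ^ (-(3 / 2) : ℝ) :=
    Summable.of_nonneg_of_le (fun n => by positivity) hle hshift.summable
  refine ⟨_, ?_, hs.hasSum⟩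
  have := hasSum_le hle hs.hasSum hshift
  linarith

/-- Peetre's inequality, from `1 + |x| ≤ (1 + |y|) (1 + |x - y|)`. -/
lemma one_add_abs_rpow_neg_mul_le {s : ℝ} (hs : 0 ≤ s) (x y : ℝ) :
    (1 + |y|) ^ (-s) ≤ (1 + |x|) ^ (-s) * (1 + |x - y|) ^ s := by
  have h1 : 1 + |x| ≤ (1 + |y|) * (1 + |x - y|) := by
    have : |x| ≤ |y| + |x - y| := by
      have := abs_add_le y (x - y)
      simpa using this
    nlinarith [abs_nonneg y, abs_nonneg (x - y), mul_nonneg (abs_nonneg y) (abs_nonneg (x - y))]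
  have h2 := Real.rpow_le_rpow (by positivity) h1 hs
  rw [Real.mul_rpow (by positivity) (by positivity)] at h2
  rw [Real.rpow_neg (by positivity), Real.rpow_neg (by positivity), inv_mul_eq_div,
    inv_eq_one_div, div_le_div_iff₀ (by positivity) (by positivity)]
  linarith

/-- The larger of `|y|` and `|x - y|` is at least `|x| / 2`, so its factor supplies the decay in `x`
while the other stays summable. -/
lemma one_add_abs_rpow_mul_le (x y : ℝ) :
    (1 + |y|) ^ (-2 : ℝ) * (1 + |x - y|) ^ (-2 : ℝ) ≤ 4 * (1 + |x|) ^ (-2 : ℝ) *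
      ((1 + |0 - y|) ^ (-(3 / 2) : ℝ) + (1 + |x - y|) ^ (-(3 / 2) : ℝ)) := by
  have hmono : ∀ z : ℝ, (1 + |z|) ^ (-2 : ℝ) ≤ (1 + |z|) ^ (-(3 / 2) : ℝ) := fun z =>
    Real.rpow_le_rpow_of_exponent_le (by linarith [abs_nonneg z]) (by norm_num)
  have hx : |x| ≤ |y| + |x - y| := by
    have := abs_add_le y (x - y)
    simpa using this
  have hhalf : ∀ z : ℝ, |x| + 1 ≤ 2 * (1 + |z|) → (1 + |z|) ^ (-2 : ℝ) ≤ 4 * (1 + |x|) ^ (-2 : ℝ) := by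
    intro z hz
    calc (1 + |z|) ^ (-2 : ℝ) ≤ ((1 + |x|) / 2) ^ (-2 : ℝ) :=
          Real.rpow_le_rpow_of_nonpos (by positivity) (by linarith) (by norm_num)
      _ = _ := by
          rw [Real.div_rpow (by positivity) (by norm_num), Real.rpow_neg (by norm_num : (0 : ℝ) ≤ 2)]
          norm_num
          ring
  have hy := hmono y
  have hxy := hmono (x - y)
  rw [zero_sub, abs_neg]
  have p1 : 0 ≤ (1 + |y|) ^ (-2 : ℝ) := by positivity
  have p2 : 0 ≤ (1 + |x - y|) ^ (-2 : ℝ) := by positivity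
  have p3 : 0 ≤ (1 + |x|) ^ (-2 : ℝ) := by positivity
  have p4 : 0 ≤ (1 + |y|) ^ (-(3 / 2) : ℝ) := by positivity
  have p5 : 0 ≤ (1 + |x - y|) ^ (-(3 / 2) : ℝ) := by positivity
  rcases le_total |y| |x - y| with h | h
  · have := hhalf (x - y) (by linarith)
    nlinarith [mul_nonneg p3 p5, mul_le_mul hy this p2 p4]
  · have := hhalf y (by linarith)
    nlinarith [mul_nonneg p3 p4, mul_le_mul hxy this p1 p5]

/-- The transform of `F H` is the sum of `c n` times translates of the transform of `H`. The term `n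
= 0` reproduces the latter, and Peetre's inequality bounds the rest. `K` depends on `H` but not on
`F`, so the next multiplier may be chosen after `K` is known. Quadratic decay survives, which
permits iteration. -/
lemma IsDecayDensity.exists_mul {H : ℝ → ℝ} (hH : IsDecayDensity H) {s : ℝ} (hs0 : 0 ≤ s)
    (hs1 : s ≤ 1 / 2) : ∃ K : ℝ, 0 < K ∧ ∀ (ε : ℝ) (F : ℝ → ℝ) (c : ℤ → ℂ), 0 ≤ ε →
      IsMultiplier s ε F c → IsDecayDensity (fun x => F x * H x) ∧
      ∀ ξ, ‖densityFourier (fun x => F x * H x) ξ - densityFourier H ξ‖ ≤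
        K * ε * (1 + |ξ|) ^ (-s) := by
  obtain ⟨K, hK0, hK⟩ := exists_hasSum_shift_rpow_le
  obtain ⟨C, hC⟩ := hH.decay
  have hC0 : 0 ≤ C := by
    have := (norm_nonneg _).trans (hC 0)
    simpa using this
  refine ⟨C * K + 1, by positivity, fun ε F c hε hF => ⟨⟨hF.continuous.mul hH.continuous,
    fun x => mul_nonneg (hF.nonneg x) (hH.nonneg x), fun x hx => by simp [hH.eq_zero x hx], ?_⟩,
    fun ξ => ?_⟩⟩
  · obtain ⟨D, hD⟩ := hF.decay_two
    have hD0 : 0 ≤ D := by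
      have := (norm_nonneg _).trans (hD 0)
      simpa using this
    refine ⟨4 * C * D * (2 * K), fun ξ => ?_⟩
    obtain ⟨S, hSK, hS⟩ := hK ξ
    obtain ⟨S', hSK', hS'⟩ := hK 0
    have hle := (hF.hasSum_densityFourier hH ξ).norm_le_of_bounded
      ((hS'.add hS).mul_left (4 * C * D * (1 + |ξ|) ^ (-2 : ℝ))) fun n => ?_
    · refine hle.trans ?_
      calc _ ≤ 4 * C * D * (1 + |ξ|) ^ (-2 : ℝ) * (K + K) := by gcongr
        _ = _ := by ring
    · rw [norm_mul]
      calc _ ≤ (D * (1 + |(n : ℝ)|) ^ (-2 : ℝ)) * (C * (1 + |ξ - n|) ^ (-2 : ℝ)) :=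
            mul_le_mul (hD n) (hC _) (norm_nonneg _) (by positivity)
        _ = C * D * ((1 + |(n : ℝ)|) ^ (-2 : ℝ) * (1 + |ξ - n|) ^ (-2 : ℝ)) := by ring
        _ ≤ C * D * _ := mul_le_mul_of_nonneg_left (one_add_abs_rpow_mul_le ξ n) (by positivity)
        _ = _ := by ring
  · obtain ⟨S, hSK, hS⟩ := hK ξ
    have h1 := (hF.hasSum_densityFourier hH ξ).sub
      (hasSum_ite_eq (0 : ℤ) (densityFourier H ξ))
    have hle := h1.norm_le_of_bounded (hS.mul_left (C * ε * (1 + |ξ|) ^ (-s))) fun n => ?_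
    · refine hle.trans ?_
      have : 0 ≤ ε * (1 + |ξ|) ^ (-s) := by positivity
      calc _ ≤ C * ε * (1 + |ξ|) ^ (-s) * K := by gcongr
        _ ≤ _ := by linarith
    · by_cases hn : n = 0
      · subst hn
        rw [if_pos rfl, hF.coeff_zero]
        simp only [Int.cast_zero, sub_zero, one_mul, sub_self, norm_zero]
        positivity
      · rw [if_neg hn, sub_zero, norm_mul]
        calc _ ≤ (ε * (1 + |(n : ℝ)|) ^ (-s)) * (C * (1 + |ξ - n|) ^ (-2 : ℝ)) :=
              mul_le_mul (hF.decay n hn) (hC _) (norm_nonneg _) (by positivity)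
          _ ≤ (ε * ((1 + |ξ|) ^ (-s) * (1 + |ξ - n|) ^ s)) * (C * (1 + |ξ - n|) ^ (-2 : ℝ)) := by
              gcongr
              exact one_add_abs_rpow_neg_mul_le hs0 ξ n
          _ = C * ε * (1 + |ξ|) ^ (-s) * (1 + |ξ - n|) ^ (s + -2) := by
              rw [Real.rpow_add (by positivity)]
              ring
          _ ≤ _ := by
              refine mul_le_mul_of_nonneg_left ?_ (by positivity)
              exact Real.rpow_le_rpow_of_exponent_le (by linarith [abs_nonneg (ξ - n)])
                (by linarith)

lemma exists_isDecayDensity : ∃ H : ℝ → ℝ, IsDecayDensity H ∧ 0 < ∫ x, H x := by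
  let f : ContDiffBump (1 / 2 : ℝ) := ⟨1 / 8, 1 / 4, by norm_num, by norm_num⟩
  have hcs : HasCompactSupport fun x => ((f x : ℝ) : ℂ) :=
    f.hasCompactSupport.comp_left (g := fun y : ℝ => (y : ℂ)) (by simp)
  have hcd : ContDiff ℝ ((⊤ : ℕ∞) : WithTop ℕ∞) fun x => ((f x : ℝ) : ℂ) :=
    Complex.ofRealCLM.contDiff.comp f.contDiff
  let g : SchwartzMap ℝ ℂ := hcs.toSchwartzMap hcd
  refine ⟨f, ⟨f.continuous, fun x => f.nonneg, fun x hx => ?_, ?_⟩, f.integral_pos⟩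
  · by_contra hne
    have hmem : x ∈ Function.support f := hne
    rw [f.support_eq, Metric.mem_ball, Real.dist_eq, abs_lt] at hmem
    apply hx
    have : f.rOut = 1 / 4 := rfl
    constructor <;> linarith [hmem.1, hmem.2]
  · refine ⟨2 ^ 2 * (Finset.Iic ((2, 0) : ℕ × ℕ)).sup
      (fun m => SchwartzMap.seminorm ℝ m.1 m.2) (FourierTransform.fourier g), fun ξ => ?_⟩
    have h := SchwartzMap.one_add_le_sup_seminorm_apply (𝕜 := ℝ) (m := (2, 0)) (k := 2) (n := 0)
      le_rfl le_rfl (FourierTransform.fourier g) ξ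
    rw [norm_iteratedFDeriv_zero] at h
    have hg : (FourierTransform.fourier g) ξ = densityFourier f ξ := by
      rw [SchwartzMap.fourier_coe, Real.fourier_real_eq_integral_exp_smul, densityFourier]
      congr 1
      ext x
      rw [smul_eq_mul, unitExp]
      congr 2
      push_cast
      ring
    rw [hg, Real.norm_eq_abs] at h
    rw [Real.rpow_neg (by positivity), ← div_eq_mul_inv, le_div_iff₀ (by positivity),
      Real.rpow_two, mul_comm]
    exact h

/-- The probability measure with density proportional to `H`. -/
noncomputable def normalizedMeasure (H : ℝ → ℝ) : Measure ℝ :=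
  volume.withDensity fun x => ENNReal.ofReal (H x / ∫ y, H y)

lemma IsDecayDensity.isProbabilityMeasure {H : ℝ → ℝ} (hH : IsDecayDensity H)
    (hpos : 0 < ∫ x, H x) : IsProbabilityMeasure (normalizedMeasure H) := by
  constructor
  rw [normalizedMeasure, withDensity_apply _ MeasurableSet.univ, Measure.restrict_univ,
    ← ofReal_integral_eq_lintegral_ofReal (hH.integrable.div_const _)
      (ae_of_all _ fun x => div_nonneg (hH.nonneg x) hpos.le), integral_div, div_self hpos.ne',
    ENNReal.ofReal_one]

lemma normalizedMeasure_eq_zero {H : ℝ → ℝ} {S : Set ℝ} (hS : MeasurableSet S)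
    (h : ∀ x ∈ S, H x = 0) : normalizedMeasure H S = 0 := by
  rw [normalizedMeasure, withDensity_apply _ hS, setLIntegral_congr_fun hS (g := fun _ => 0)]
  · simp
  · intro x hx
    simp [h x hx]

lemma IsDecayDensity.measureFourier_normalizedMeasure {H : ℝ → ℝ} (hH : IsDecayDensity H)
    (ξ : ℝ) : measureFourier (normalizedMeasure H) ξ =
      densityFourier H ξ / ((∫ x, H x : ℝ) : ℂ) := by
  have hm : Measurable fun x => ENNReal.ofReal (H x / ∫ y, H y) :=
    (hH.continuous.measurable.div_const _).ennreal_ofReal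
  rw [measureFourier_eq, normalizedMeasure, integral_withDensity_eq_integral_toReal_smul hm
    (ae_of_all _ fun x => ENNReal.ofReal_lt_top), densityFourier, ← integral_div]
  congr 1
  ext x
  rw [ENNReal.toReal_ofReal (div_nonneg (hH.nonneg x) (integral_nonneg hH.nonneg)),
    Complex.real_smul]
  push_cast
  ring

/-- Weak compactness: a sequence of probability measures on the unit interval has a limit along an
ultrafilter, which inherits null open sets and Fourier bounds. -/
lemma exists_weak_limit {μ : ℕ → Measure ℝ} (hμ : ∀ n, IsProbabilityMeasure (μ n))
    (hsupp : ∀ n, μ n (Icc 0 1)ᶜ = 0) :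
    ∃ ν : Measure ℝ, IsProbabilityMeasure ν ∧
      (∀ U : Set ℝ, IsOpen U → (∀ᶠ n in atTop, μ n U = 0) → ν U = 0) ∧
      ∀ (ξ M : ℝ), (∀ n, ‖measureFourier (μ n) ξ‖ ≤ M) → ‖measureFourier ν ξ‖ ≤ M := by
  let P : ℕ → ProbabilityMeasure ℝ := fun n => ⟨μ n, hμ n⟩
  have htight : IsTightMeasureSet
      {((m : ProbabilityMeasure ℝ) : Measure ℝ) | m ∈ range P} := by
    rw [isTightMeasureSet_iff_exists_isCompact_measure_compl_le]
    intro ε _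
    refine ⟨Icc 0 1, isCompact_Icc, ?_⟩
    rintro _ ⟨_, ⟨n, rfl⟩, rfl⟩
    exact (hsupp n).le.trans zero_le
  have hcomp := isCompact_closure_of_isTightMeasureSet htight
  obtain ⟨ν, -, hν⟩ := hcomp.ultrafilter_le_nhds ((hyperfilter ℕ).map P) (by
    rw [le_principal_iff, Ultrafilter.mem_coe, Ultrafilter.mem_map]
    exact Filter.univ_mem' fun n => subset_closure ⟨n, rfl⟩)
  have hlim : Tendsto P (hyperfilter ℕ : Filter ℕ) (𝓝 ν) := hν
  refine ⟨ν, inferInstance, fun U hU h0 => ?_, fun ξ M hM => ?_⟩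
  · have h1 := ProbabilityMeasure.le_liminf_measure_open_of_tendsto hlim hU
    have h2 : ∀ᶠ n in (hyperfilter ℕ : Filter ℕ), (P n : Measure ℝ) U = 0 :=
      h0.filter_mono Nat.hyperfilter_le_atTop
    rw [liminf_congr h2] at h1
    simpa using h1
  · rw [ProbabilityMeasure.tendsto_iff_forall_integral_rclike_tendsto ℂ] at hlim
    have hcont : Continuous fun x => unitExp (-(ξ * x)) := continuous_unitExp.comp (by fun_prop)
    have h3 := hlim (BoundedContinuousFunction.ofNormedAddCommGroup _ hcont 1
      fun x => (norm_unitExp _).le)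
    simp only [BoundedContinuousFunction.coe_ofNormedAddCommGroup] at h3
    rw [measureFourier_eq]
    refine le_of_tendsto h3.norm (Eventually.of_forall fun n => ?_)
    have := hM n
    rwa [measureFourier_eq] at this

/-- A product construction: the errors form a geometric series with total at most half the initial
mass, so the mass stays bounded below. Closedness of `Z j` makes its complement open, so its nullity
passes to the weak limit. -/
lemma exists_measure_of_multipliers {s : ℝ} (hs0 : 0 ≤ s) (hs1 : s ≤ 1 / 2) {Z : ℕ → Set ℝ}
    (hZ : ∀ j, IsClosed (Z j))
    (hmult : ∀ ε : ℝ, 0 < ε → ∀ J : ℕ, ∃ j, J ≤ j ∧ ∃ (F : ℝ → ℝ) (c : ℤ → ℂ),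
      IsMultiplier s ε F c ∧ ∀ x, F x ≠ 0 → x ∈ Z j) :
    ∃ ν : Measure ℝ, IsProbabilityMeasure ν ∧
      (∀ᵐ x ∂ν, x ∈ Icc (0 : ℝ) 1 ∧ {j | x ∈ Z j}.Infinite) ∧
      ∃ C : ℝ, ∀ ξ, ‖measureFourier ν ξ‖ ≤ C * (1 + |ξ|) ^ (-s) := by
  have hstep : ∀ (H : {H : ℝ → ℝ // IsDecayDensity H}) (J : ℕ) (ε : ℝ), 0 < ε →
      ∃ (j : ℕ) (H' : {H : ℝ → ℝ // IsDecayDensity H}), J ≤ j ∧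
        (∀ x, H'.1 x ≠ 0 → H.1 x ≠ 0 ∧ x ∈ Z j) ∧
        ∀ ξ, ‖densityFourier H'.1 ξ - densityFourier H.1 ξ‖ ≤ ε * (1 + |ξ|) ^ (-s) := by
    intro H J ε hε
    obtain ⟨K, hK0, hK⟩ := H.2.exists_mul hs0 hs1
    obtain ⟨j, hj, F, c, hF, hFZ⟩ := hmult (ε / K) (by positivity) J
    obtain ⟨h1, h2⟩ := hK (ε / K) F c (by positivity) hF
    refine ⟨j, ⟨_, h1⟩, hj, fun x hx => ⟨right_ne_zero_of_mul hx, hFZ x (left_ne_zero_of_mul hx)⟩,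
      fun ξ => ?_⟩
    have := h2 ξ
    rwa [mul_div_cancel₀ _ hK0.ne'] at this
  choose! nj nH hj hsub hclose using hstep
  obtain ⟨H₀, hH₀, hm₀⟩ := exists_isDecayDensity
  set m₀ := ∫ x, H₀ x with hm₀def
  -- The state is a density together with a lower bound for the next index; the `+ 1` forces the
  -- chosen indices to increase strictly.
  let P : ℕ → {H : ℝ → ℝ // IsDecayDensity H} × ℕ := fun n => Nat.rec (⟨H₀, hH₀⟩, 0)
    (fun k p => (nH p.1 p.2 (m₀ / 2 * (1 / 2) ^ (k + 1)), nj p.1 p.2 (m₀ / 2 * (1 / 2) ^ (k + 1)) + 1)) n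
  let idx : ℕ → ℕ := fun k => nj (P k).1 (P k).2 (m₀ / 2 * (1 / 2) ^ (k + 1))
  have hε : ∀ k : ℕ, 0 < m₀ / 2 * (1 / 2) ^ (k + 1) := fun k => by positivity
  have hPsub : ∀ k x, (P (k + 1)).1.1 x ≠ 0 → (P k).1.1 x ≠ 0 ∧ x ∈ Z (idx k) := fun k =>
    hsub (P k).1 (P k).2 _ (hε k)
  have hPclose : ∀ k ξ, ‖densityFourier (P (k + 1)).1.1 ξ - densityFourier (P k).1.1 ξ‖ ≤
      m₀ / 2 * (1 / 2) ^ (k + 1) * (1 + |ξ|) ^ (-s) := fun k =>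
    hclose (P k).1 (P k).2 _ (hε k)
  have hidx : StrictMono idx := strictMono_nat_of_lt_succ fun k =>
    hj (P (k + 1)).1 (P (k + 1)).2 _ (hε (k + 1))
  have hdist : ∀ n ξ, ‖densityFourier (P n).1.1 ξ - densityFourier H₀ ξ‖ ≤
      m₀ / 2 * (1 - (1 / 2) ^ n) * (1 + |ξ|) ^ (-s) := by
    intro n ξ
    induction n with
    | zero =>
      have : (P 0).1.1 = H₀ := rfl
      simp [this]
    | succ k ih =>
      calc _ ≤ ‖densityFourier (P (k + 1)).1.1 ξ - densityFourier (P k).1.1 ξ‖ +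
            ‖densityFourier (P k).1.1 ξ - densityFourier H₀ ξ‖ := norm_sub_le_norm_sub_add_norm_sub ..
        _ ≤ _ := add_le_add (hPclose k ξ) ih
        _ = _ := by ring
  have hdist' : ∀ n ξ, ‖densityFourier (P n).1.1 ξ - densityFourier H₀ ξ‖ ≤
      m₀ / 2 * (1 + |ξ|) ^ (-s) := by
    intro n ξ
    refine (hdist n ξ).trans ?_
    gcongr
    have : (0 : ℝ) ≤ (1 / 2) ^ n := by positivity
    nlinarith
  have hmass : ∀ n, m₀ / 2 ≤ ∫ x, (P n).1.1 x := by
    intro n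
    have := hdist' n 0
    rw [densityFourier_zero, densityFourier_zero, ← Complex.ofReal_sub, Complex.norm_real,
      Real.norm_eq_abs] at this
    simp only [abs_zero, add_zero, Real.one_rpow, mul_one] at this
    linarith [(abs_le.1 this).1]
  have hmass0 : ∀ n, 0 < ∫ x, (P n).1.1 x := fun n => lt_of_lt_of_le (by positivity) (hmass n)
  have hzero : ∀ n k, k < n → ∀ x, (P n).1.1 x ≠ 0 → x ∈ Z (idx k) := by
    intro n k hkn
    induction n with
    | zero => omega
    | succ m ih =>
      intro x hx
      rcases Nat.lt_succ_iff_lt_or_eq.1 hkn with h | rfl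
      · exact ih h x (hPsub m x hx).1
      · exact (hPsub k x hx).2
  obtain ⟨C, hC⟩ := hH₀.decay
  have hC0 : 0 ≤ C := by
    have := (norm_nonneg _).trans (hC 0)
    simpa using this
  obtain ⟨ν, hν, hopen, hfour⟩ := exists_weak_limit
    (fun n => (P n).1.2.isProbabilityMeasure (hmass0 n))
    (fun n => normalizedMeasure_eq_zero measurableSet_Icc.compl (P n).1.2.eq_zero)
  refine ⟨ν, hν, ?_, (C + m₀ / 2) / (m₀ / 2), fun ξ => hfour ξ _ fun n => ?_⟩
  · have hI : ∀ᵐ x ∂ν, x ∈ Icc (0 : ℝ) 1 := hopen _ isClosed_Icc.isOpen_compl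
      (Eventually.of_forall fun n =>
        normalizedMeasure_eq_zero measurableSet_Icc.compl (P n).1.2.eq_zero)
    have hall : ∀ᵐ x ∂ν, ∀ k, x ∈ Z (idx k) := by
      refine ae_all_iff.2 fun k => hopen _ (hZ _).isOpen_compl ?_
      filter_upwards [eventually_gt_atTop k] with n hn
      refine normalizedMeasure_eq_zero (hZ _).measurableSet.compl fun x hx => ?_
      by_contra hne
      exact hx (hzero n k hn x hne)
    filter_upwards [hI, hall] with x hx1 hx2
    exact ⟨hx1, (infinite_range_of_injective hidx.injective).mono (by
      rintro _ ⟨k, rfl⟩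
      exact hx2 k)⟩
  · rw [(P n).1.2.measureFourier_normalizedMeasure, norm_div, Complex.norm_real,
      Real.norm_of_nonneg (hmass0 n).le]
    have h1 : ‖densityFourier (P n).1.1 ξ‖ ≤ (C + m₀ / 2) * (1 + |ξ|) ^ (-s) := by
      have h2 : ‖densityFourier H₀ ξ‖ ≤ C * (1 + |ξ|) ^ (-s) := by
        refine (hC ξ).trans (mul_le_mul_of_nonneg_left ?_ hC0)
        exact Real.rpow_le_rpow_of_exponent_le (by linarith [abs_nonneg ξ]) (by linarith)
      have h3 := norm_le_norm_add_norm_sub' (densityFourier (P n).1.1 ξ) (densityFourier H₀ ξ)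
      linarith [hdist' n ξ]
    calc _ ≤ (C + m₀ / 2) * (1 + |ξ|) ^ (-s) / (m₀ / 2) :=
          div_le_div₀ (by positivity) h1 (by positivity) (hmass n)
      _ = _ := by ring

/-! ### Dyadic levels with many denominators -/

/-- The indices `q` for which `ψ q / q` lies in the dyadic interval `(2 ^ (-(j + 1)), 2 ^ (-j)]`. -/
def dyadicLevel {Q : Set ℕ} (ψ : Q → ℝ) (j : ℕ) : Set Q :=
  {q | (1 / 2 : ℝ) ^ (j + 1) < ψ q / (q : ℕ) ∧ ψ q / (q : ℕ) ≤ (1 / 2) ^ j}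

lemma le_two_pow_of_mem_dyadicLevel {Q : Set ℕ} (hQ : ∀ q ∈ Q, 0 < q) {ψ : Q → ℝ}
    (hψ : ∀ q : Q, 0 ≤ ψ q ∧ ψ q < 1 / 2) {j : ℕ} {q : Q} (hq : q ∈ dyadicLevel ψ j) :
    (q : ℕ) ≤ 2 ^ j := by
  have hq0 : (0 : ℝ) < (q : ℕ) := by exact_mod_cast hQ q q.2
  have h1 := hq.1
  rw [lt_div_iff₀ hq0, one_div_pow, one_div_mul_eq_div, div_lt_iff₀ (by positivity)] at h1
  have h2 : ((q : ℕ) : ℝ) ≤ 2 ^ j := by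
    have h3 : (0 : ℝ) < 2 ^ j := by positivity
    rw [pow_succ] at h1
    nlinarith [(hψ q).2]
  exact_mod_cast h2

lemma finite_dyadicLevel {Q : Set ℕ} (hQ : ∀ q ∈ Q, 0 < q) {ψ : Q → ℝ}
    (hψ : ∀ q : Q, 0 ≤ ψ q ∧ ψ q < 1 / 2) (j : ℕ) : (dyadicLevel ψ j).Finite :=
  ((Set.finite_Iic (2 ^ j)).preimage Subtype.val_injective.injOn).subset fun _ hq =>
    le_two_pow_of_mem_dyadicLevel hQ hψ hq

lemma dyadicLevel_unique {Q : Set ℕ} {ψ : Q → ℝ} {j k : ℕ} {q : Q} (hj : q ∈ dyadicLevel ψ j)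
    (hk : q ∈ dyadicLevel ψ k) : j = k := by
  have key : ∀ {j k : ℕ}, q ∈ dyadicLevel ψ j → q ∈ dyadicLevel ψ k → ¬ j < k := by
    intro j k hj hk h
    have := pow_le_pow_of_le_one (by norm_num : (0 : ℝ) ≤ 1 / 2) (by norm_num) (show j + 1 ≤ k from h)
    linarith [hj.1, hk.2]
  exact le_antisymm (not_lt.1 (key hk hj)) (not_lt.1 (key hj hk))

/-- Otherwise the level counts are `O(2 ^ (j t))`, and for `t < t' < convExponent Q ψ` the series
with exponent `t'` is dominated by a geometric series of ratio `2 ^ (t - t') < 1`. -/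
lemma exists_large_dyadicLevel {Q : Set ℕ} (hQ : ∀ q ∈ Q, 0 < q) {ψ : Q → ℝ}
    (hψ : ∀ q : Q, 0 ≤ ψ q ∧ ψ q < 1 / 2) {t : ℝ} (ht0 : 0 ≤ t) (ht : t < convExponent Q ψ)
    (J : ℕ) : ∃ j, J ≤ j ∧ (2 : ℝ) ^ (j * t) ≤ (finite_dyadicLevel hQ hψ j).toFinset.card := by
  classical
  by_contra! hcon
  obtain ⟨t', htt', ht'⟩ := exists_between ht
  have ht'0 : 0 < t' := ht0.trans_lt htt'
  have hx0 : ∀ q : Q, 0 ≤ ψ q / (q : ℕ) := fun q => div_nonneg (hψ q).1 (Nat.cast_nonneg _)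
  suffices Summable fun q : Q => (ψ q / ((q : ℕ) : ℝ)) ^ t' by
    have : convExponent Q ψ ≤ t' := csInf_le ⟨0, fun x hx => hx.1⟩ ⟨ht'0.le, this⟩
    linarith
  set n : ℕ → ℝ := fun j => (finite_dyadicLevel hQ hψ j).toFinset.card with hn
  -- `L` also absorbs the finitely many levels below `J`, where no bound is assumed.
  set L : ℝ := 1 + ∑ j ∈ Finset.range J, n j with hL
  have hsum0 : 0 ≤ ∑ j ∈ Finset.range J, n j := Finset.sum_nonneg fun _ _ => Nat.cast_nonneg _
  have hnL : ∀ j, n j ≤ L * (2 : ℝ) ^ (j * t) := by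
    intro j
    have h1 : (1 : ℝ) ≤ (2 : ℝ) ^ (j * t) := Real.one_le_rpow (by norm_num) (by positivity)
    rcases lt_or_ge j J with h | h
    · have h2 : n j ≤ ∑ j ∈ Finset.range J, n j :=
        Finset.single_le_sum (f := n) (fun _ _ => Nat.cast_nonneg _) (Finset.mem_range.2 h)
      nlinarith
    · have := (hcon j h).le
      nlinarith
  set r : ℝ := (2 : ℝ) ^ (t - t') with hr
  have hr0 : 0 ≤ r := by positivity
  have hr1 : r < 1 := Real.rpow_lt_one_of_one_lt_of_neg (by norm_num) (by linarith)
  have hlevel : ∀ q : Q, 0 < ψ q → ∃ j, q ∈ dyadicLevel ψ j := by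
    intro q hq
    have hq0 : (1 : ℝ) ≤ (q : ℕ) := by exact_mod_cast hQ q q.2
    refine exists_nat_pow_near_of_lt_one (div_pos hq (by linarith)) ?_ (by norm_num) (by norm_num)
    rw [div_le_one (by linarith)]
    linarith [(hψ q).2]
  choose! lev hlev using hlevel
  refine summable_of_sum_le (c := L * (1 - r)⁻¹) (fun q => Real.rpow_nonneg (hx0 q) _) fun u => ?_
  have hzero : ∀ q ∈ u, (ψ q / ((q : ℕ) : ℝ)) ^ t' ≠ 0 → 0 < ψ q := by
    intro q _ hne
    refine (hψ q).1.lt_of_ne fun h => hne ?_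
    rw [← h, zero_div, Real.zero_rpow ht'0.ne']
  rw [← Finset.sum_filter_of_ne hzero,
    ← Finset.sum_fiberwise_of_maps_to (t := (u.filter fun q => 0 < ψ q).image lev) (g := lev)
      fun q hq => Finset.mem_image_of_mem _ hq]
  calc _ ≤ ∑ j ∈ (u.filter fun q => 0 < ψ q).image lev, L * r ^ j := by
        refine Finset.sum_le_sum fun j _ => ?_
        calc _ ≤ ∑ q ∈ (u.filter fun q => 0 < ψ q).filter (fun q => lev q = j),
              ((1 / 2 : ℝ) ^ j) ^ t' := by
              refine Finset.sum_le_sum fun q hq => ?_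
              simp only [Finset.mem_filter] at hq
              have := hlev q hq.1.2
              rw [hq.2] at this
              exact Real.rpow_le_rpow (hx0 q) this.2 ht'0.le
          _ ≤ n j * ((1 / 2 : ℝ) ^ j) ^ t' := by
              rw [Finset.sum_const, nsmul_eq_mul]
              gcongr
              refine Nat.cast_le.2 (Finset.card_le_card fun q hq => ?_)
              simp only [Finset.mem_filter] at hq
              rw [Set.Finite.mem_toFinset, ← hq.2]
              exact hlev q hq.1.2
          _ ≤ L * (2 : ℝ) ^ (j * t) * ((1 / 2 : ℝ) ^ j) ^ t' := by
              gcongr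
              exact hnL j
          _ = L * r ^ j := by
              rw [mul_assoc]
              congr 1
              rw [hr, ← Real.rpow_natCast (1 / 2 : ℝ), ← Real.rpow_mul (by norm_num), one_div,
                Real.inv_rpow (by norm_num), ← Real.rpow_neg (by norm_num),
                ← Real.rpow_add (by norm_num), ← Real.rpow_natCast, ← Real.rpow_mul (by norm_num)]
              congr 1
              ring
    _ = L * ∑ j ∈ (u.filter fun q => 0 < ψ q).image lev, r ^ j := (Finset.mul_sum ..).symm
    _ ≤ L * (1 - r)⁻¹ := by
        refine mul_le_mul_of_nonneg_left ?_ (by linarith)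
        rw [← tsum_geometric_of_lt_one hr0 hr1]
        exact (summable_geometric_of_lt_one hr0 hr1).sum_le_tsum _ fun _ _ => by positivity

lemma sum_div_of_dvd_le (S : Finset ℕ) {X : ℕ} (hS : ∀ q ∈ S, 0 < q ∧ q ≤ X) {d : ℕ}
    (hd : 0 < d) : ∑ q ∈ S.filter (fun q => d ∣ q), (d : ℝ) / q ≤ 1 + Real.log X := by
  have hd0 : (d : ℝ) ≠ 0 := by exact_mod_cast hd.ne'
  refine le_trans ?_ (harmonic_le_one_add_log X)
  rw [harmonic]
  push_cast
  calc _ = ∑ q ∈ S.filter (fun q => d ∣ q), (((q / d - 1 : ℕ) : ℝ) + 1)⁻¹ := by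
        refine Finset.sum_congr rfl fun q hq => ?_
        rw [Finset.mem_filter] at hq
        have h1 : 1 ≤ q / d := Nat.div_pos (Nat.le_of_dvd (hS q hq.1).1 hq.2) hd
        rw [Nat.cast_sub h1, Nat.cast_div hq.2 hd0]
        simp
    _ = ∑ i ∈ (S.filter (fun q => d ∣ q)).image (fun q => q / d - 1), ((i : ℝ) + 1)⁻¹ := by
        rw [Finset.sum_image]
        intro q hq q' hq' h
        simp only [Finset.coe_filter, mem_ofPred_eq] at hq hq'
        have h1 : 1 ≤ q / d := Nat.div_pos (Nat.le_of_dvd (hS q hq.1).1 hq.2) hd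
        have h2 : 1 ≤ q' / d := Nat.div_pos (Nat.le_of_dvd (hS q' hq'.1).1 hq'.2) hd
        have h3 : q / d = q' / d := by
          have h4 : q / d - 1 = q' / d - 1 := h
          omega
        rw [← Nat.div_mul_cancel hq.2, h3, Nat.div_mul_cancel hq'.2]
    _ ≤ _ := by
        refine Finset.sum_le_sum_of_subset_of_nonneg (fun i hi => ?_) fun _ _ _ => by positivity
        obtain ⟨q, hq, rfl⟩ := Finset.mem_image.1 hi
        rw [Finset.mem_filter] at hq
        have h1 : 1 ≤ q / d := Nat.div_pos (Nat.le_of_dvd (hS q hq.1).1 hq.2) hd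
        have h2 : q / d ≤ X := (Nat.div_le_self q d).trans (hS q hq.1).2
        rw [Finset.mem_range]
        omega

/-- Exchanging the sums leaves, for each `d ∣ n`, the sum of `d / q` over multiples `q` of `d`,
which is part of a harmonic sum. This is the gain from averaging over `q`. -/
lemma sum_sum_common_divisors_le (S : Finset ℕ) {X : ℕ}
    (hS : ∀ q ∈ S, 0 < q ∧ q ≤ X) {n : ℤ} (hn : n ≠ 0) :
    ∑ q ∈ S, (∑ d ∈ q.divisors.filter (fun d : ℕ => (d : ℤ) ∣ n), (d : ℝ)) / q ≤
      n.natAbs.divisors.card * (1 + Real.log X) := by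
  calc _ = ∑ q ∈ S, ∑ d ∈ n.natAbs.divisors, if d ∣ q then (d : ℝ) / q else 0 := by
        refine Finset.sum_congr rfl fun q hq => ?_
        rw [Finset.sum_div, ← Finset.sum_filter]
        refine Finset.sum_congr ?_ fun _ _ => rfl
        ext d
        simp only [Finset.mem_filter, Nat.mem_divisors, Int.natAbs_eq_zero, ne_eq,
          Int.natCast_dvd]
        have := (hS q hq).1.ne'
        tauto
    _ = ∑ d ∈ n.natAbs.divisors, ∑ q ∈ S.filter (fun q => d ∣ q), (d : ℝ) / q := by
        rw [Finset.sum_comm]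
        refine Finset.sum_congr rfl fun d _ => (Finset.sum_filter ..).symm
    _ ≤ ∑ d ∈ n.natAbs.divisors, (1 + Real.log X) :=
        Finset.sum_le_sum fun d hd => sum_div_of_dvd_le S hS (Nat.pos_of_mem_divisors hd)
    _ = _ := by rw [Finset.sum_const, nsmul_eq_mul]

/-! ### Averaged combs as multipliers -/

/-- The average over `q ∈ S` of the normalized tent combs. -/
noncomputable def averagedComb (A B : ℕ → ℤ) (θ : ℕ → ℝ) (S : Finset ℕ) (η x : ℝ) : ℝ :=
  (∑ q ∈ S, tentComb q (A q) (B q) (θ q) η x / (goodResidues q (A q) (B q)).card) / S.card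

/-- The Fourier coefficients of `averagedComb`. -/
noncomputable def averagedCombCoeff (A B : ℕ → ℤ) (θ : ℕ → ℝ) (S : Finset ℕ) (η : ℝ) (n : ℤ) : ℂ :=
  ((Real.sinc (Real.pi * η * n) ^ 2 : ℝ) : ℂ) *
    ((∑ q ∈ S, residueSum q (A q) (B q) (θ q) n / (goodResidues q (A q) (B q)).card) / S.card)

lemma card_goodResidues_pos {q : ℕ} (hq : 0 < q) {a b : ℤ} (hab : Int.gcd a b = 1) :
    (0 : ℝ) < (goodResidues q a b).card := by
  rw [card_goodResidues hq hab]
  have h1 := inv_card_divisors_le_coprimeDensity hq b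
  have h2 : 0 < q.divisors.card := Finset.card_pos.2 ⟨1, Nat.one_mem_divisors.2 hq.ne'⟩
  have h3 : (0 : ℝ) < 1 / q.divisors.card := by positivity
  have : 0 < coprimeDensity q b := h3.trans_le h1
  positivity

lemma hasSum_averagedComb (A B : ℕ → ℤ) (θ : ℕ → ℝ) (S : Finset ℕ) {η : ℝ} (hη : 0 < η)
    (hη' : η ≤ 1 / 2) (x : ℝ) :
    HasSum (fun n : ℤ => averagedCombCoeff A B θ S η n * unitExp (n * x))
      (averagedComb A B θ S η x : ℂ) := by
  have h := (hasSum_sum fun q (_ : q ∈ S) => (hasSum_tentComb q (A q) (B q) (θ q) hη hη' x).div_const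
    ((goodResidues q (A q) (B q)).card : ℂ)).div_const (S.card : ℂ)
  have e1 : ∀ n : ℤ, averagedCombCoeff A B θ S η n * unitExp (n * x) =
      (∑ q ∈ S, ((Real.sinc (Real.pi * η * n) ^ 2 : ℝ) : ℂ) * residueSum q (A q) (B q) (θ q) n *
        unitExp (n * x) / (goodResidues q (A q) (B q)).card) / S.card := by
    intro n
    rw [averagedCombCoeff, mul_div_assoc', div_mul_eq_mul_div, Finset.mul_sum, Finset.sum_mul]
    congr 1
    refine Finset.sum_congr rfl fun q _ => ?_
    ring
  have e2 : (averagedComb A B θ S η x : ℂ) =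
      (∑ q ∈ S, (tentComb q (A q) (B q) (θ q) η x : ℂ) / (goodResidues q (A q) (B q)).card) /
        S.card := by
    rw [averagedComb]
    push_cast
    rfl
  simp_rw [e1, e2]
  exact h

lemma averagedCombCoeff_zero {A B : ℕ → ℤ} {θ : ℕ → ℝ} {S : Finset ℕ} (hS : S.Nonempty)
    (hS0 : ∀ q ∈ S, 0 < q) (hAB : ∀ q ∈ S, Int.gcd (A q) (B q) = 1) (η : ℝ) :
    averagedCombCoeff A B θ S η 0 = 1 := by
  have h : ∀ q ∈ S, residueSum q (A q) (B q) (θ q) 0 / (goodResidues q (A q) (B q)).card = 1 := by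
    intro q hq
    rw [residueSum_zero, div_self]
    have := card_goodResidues_pos (hS0 q hq) (hAB q hq)
    exact_mod_cast this.ne'
  have hc : (S.card : ℂ) ≠ 0 := by exact_mod_cast hS.card_pos.ne'
  rw [averagedCombCoeff, Finset.sum_congr rfl h]
  simp [hc]

lemma norm_averagedCombCoeff_le_sinc (A B : ℕ → ℤ) (θ : ℕ → ℝ) (S : Finset ℕ) (η : ℝ) (n : ℤ) :
    ‖averagedCombCoeff A B θ S η n‖ ≤ Real.sinc (Real.pi * η * n) ^ 2 := by
  rw [averagedCombCoeff, norm_mul, Complex.norm_real, Real.norm_of_nonneg (sq_nonneg _)]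
  refine mul_le_of_le_one_right (sq_nonneg _) ?_
  rw [norm_div, Complex.norm_natCast]
  refine div_le_one_of_le₀ ?_ (Nat.cast_nonneg _)
  refine (norm_sum_le _ _).trans ?_
  calc _ ≤ ∑ q ∈ S, (1 : ℝ) := Finset.sum_le_sum fun q _ => by
        rw [norm_div, Complex.norm_natCast]
        exact div_le_one_of_le₀ (norm_residueSum_le_card ..) (Nat.cast_nonneg _)
    _ = _ := by simp

lemma sinc_sq_le_decay {v : ℝ} (hv : 0 < v) (n : ℤ) :
    Real.sinc (v * n) ^ 2 ≤ (1 + 4 / v ^ 2) * (1 + |(n : ℝ)|) ^ (-2 : ℝ) := by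
  by_cases hn : n = 0
  · subst hn
    have : 0 < 4 / v ^ 2 := by positivity
    simp
    linarith
  · have hn1 : 1 ≤ |(n : ℝ)| := by exact_mod_cast Int.one_le_abs hn
    have hn0 : (n : ℝ) ≠ 0 := by exact_mod_cast hn
    have h4 : (1 + |(n : ℝ)|) ^ 2 ≤ 4 * (n : ℝ) ^ 2 := by
      rw [← sq_abs (n : ℝ)]
      nlinarith
    rw [Real.rpow_neg (by positivity), Real.rpow_two, ← div_eq_mul_inv, le_div_iff₀ (by positivity)]
    calc _ ≤ 1 / (v * n) ^ 2 * (4 * (n : ℝ) ^ 2) :=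
          mul_le_mul (sinc_sq_le_inv_sq (by positivity)) h4 (by positivity) (by positivity)
      _ = 4 / v ^ 2 := by field_simp
      _ ≤ _ := by linarith

/-- Interpolation between the trivial bound `1` and quadratic decay. -/
lemma sinc_sq_le_rpow {X y β : ℝ} (hX : 0 < X) (hy : y ≠ 0) (h0 : 0 ≤ β) (h2 : β ≤ 2) :
    Real.sinc (Real.pi / (4 * X) * y) ^ 2 ≤ 2 * (X / |y|) ^ β := by
  have hy0 : 0 < |y| := abs_pos.2 hy
  have hpi := Real.pi_gt_three
  rcases le_total 1 (X / |y|) with h | h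
  · have := Real.one_le_rpow h h0
    linarith [sinc_sq_le_one (Real.pi / (4 * X) * y)]
  · calc _ ≤ 1 / (Real.pi / (4 * X) * y) ^ 2 := sinc_sq_le_inv_sq (by positivity)
      _ = 16 / Real.pi ^ 2 * (X / |y|) ^ 2 := by
          rw [div_pow X, sq_abs]
          field_simp
          norm_num
      _ ≤ 2 * (X / |y|) ^ 2 := by
          gcongr
          rw [div_le_iff₀ (by positivity)]
          nlinarith
      _ ≤ _ := by
          rw [← Real.rpow_two]
          gcongr 2 * ?_
          exact Real.rpow_le_rpow_of_exponent_ge (by positivity) h h2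

/-- There are at least `q / d(q)` good residues, so normalizing costs only the divisor count `d(q) ≤
K X ^ e`. Averaging the common-divisor sums costs a further `K |n| ^ e` and a logarithm, leaving
essentially `1 / S.card`. -/
lemma norm_averagedCombCoeff_le {A B : ℕ → ℤ} {θ : ℕ → ℝ} {S : Finset ℕ} {X : ℕ} (hX : 0 < X)
    (hS : ∀ q ∈ S, 0 < q ∧ q ≤ X) (hAB : ∀ q ∈ S, Int.gcd (A q) (B q) = 1) {e K : ℝ} (he : 0 ≤ e)
    (hK0 : 0 ≤ K) (hK : ∀ n : ℕ, 0 < n → (n.divisors.card : ℝ) ≤ K * (n : ℝ) ^ e) (η : ℝ) {n : ℤ}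
    (hn : n ≠ 0) :
    ‖averagedCombCoeff A B θ S η n‖ ≤ Real.sinc (Real.pi * η * n) ^ 2 *
      (K ^ 2 * (X : ℝ) ^ e * |(n : ℝ)| ^ e * (1 + Real.log X) / S.card) := by
  rw [averagedCombCoeff, norm_mul, Complex.norm_real, Real.norm_of_nonneg (sq_nonneg _), norm_div,
    Complex.norm_natCast]
  gcongr
  have hlog : 0 ≤ Real.log X := Real.log_natCast_nonneg X
  calc _ ≤ ∑ q ∈ S, K * (X : ℝ) ^ e *
        ((∑ d ∈ q.divisors.filter (fun d : ℕ => (d : ℤ) ∣ n), (d : ℝ)) / q) := by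
        refine (norm_sum_le _ _).trans (Finset.sum_le_sum fun q hq => ?_)
        have hq0 : (0 : ℝ) < q := by exact_mod_cast (hS q hq).1
        have hqX : (q : ℝ) ≤ X := by exact_mod_cast (hS q hq).2
        have hτ : (0 : ℝ) < q.divisors.card := by
          exact_mod_cast Finset.card_pos.2 ⟨1, Nat.one_mem_divisors.2 (hS q hq).1.ne'⟩
        have h1 : (q : ℝ) / q.divisors.card ≤ (goodResidues q (A q) (B q)).card := by
          rw [card_goodResidues (hS q hq).1 (hAB q hq), div_eq_mul_one_div]
          exact mul_le_mul_of_nonneg_left (inv_card_divisors_le_coprimeDensity (hS q hq).1 _) hq0.le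
        have h2 : (q.divisors.card : ℝ) ≤ K * (X : ℝ) ^ e :=
          (hK q (hS q hq).1).trans (by gcongr)
        rw [norm_div, Complex.norm_natCast]
        calc _ ≤ (∑ d ∈ q.divisors.filter (fun d : ℕ => (d : ℤ) ∣ n), (d : ℝ)) /
              (q / q.divisors.card) :=
              div_le_div₀ (Finset.sum_nonneg fun _ _ => Nat.cast_nonneg _)
                (norm_residueSum_le (hS q hq).1 (hAB q hq) _ n) (by positivity) h1
          _ = q.divisors.card *
              ((∑ d ∈ q.divisors.filter (fun d : ℕ => (d : ℤ) ∣ n), (d : ℝ)) / q) := by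
              field_simp
          _ ≤ _ := by gcongr
    _ ≤ K * (X : ℝ) ^ e * (n.natAbs.divisors.card * (1 + Real.log X)) := by
        rw [← Finset.mul_sum]
        gcongr
        exact sum_sum_common_divisors_le S hS hn
    _ ≤ K * (X : ℝ) ^ e * (K * |(n : ℝ)| ^ e * (1 + Real.log X)) := by
        gcongr
        have := hK n.natAbs (Int.natAbs_pos.2 hn)
        rwa [Nat.cast_natAbs, Int.cast_abs] at this
    _ = _ := by ring

lemma isMultiplier_averagedComb {A B : ℕ → ℤ} {θ : ℕ → ℝ} {S : Finset ℕ} {X : ℕ} (hX : 0 < X)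
    (hne : S.Nonempty) (hS : ∀ q ∈ S, 0 < q ∧ q ≤ X) (hAB : ∀ q ∈ S, Int.gcd (A q) (B q) = 1)
    {s e K : ℝ} (hs0 : 0 ≤ s) (hs1 : s ≤ 1 / 2) (he : 0 ≤ e) (he1 : e ≤ 1) (hK0 : 0 ≤ K)
    (hK : ∀ n : ℕ, 0 < n → (n.divisors.card : ℝ) ≤ K * (n : ℝ) ^ e) :
    IsMultiplier s (4 * K ^ 2 * (1 + Real.log X) * (X : ℝ) ^ (s + 2 * e) / S.card)
      (averagedComb A B θ S (1 / (4 * X))) (averagedCombCoeff A B θ S (1 / (4 * X))) := by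
  have hX1 : (1 : ℝ) ≤ X := by exact_mod_cast hX
  have hX0 : (0 : ℝ) < X := by linarith
  have hη : (0 : ℝ) < 1 / (4 * X) := by positivity
  have hη' : (1 : ℝ) / (4 * X) ≤ 1 / 2 := one_div_le_one_div_of_le (by norm_num) (by linarith)
  have hlog : 0 ≤ Real.log X := Real.log_natCast_nonneg X
  refine ⟨?_, fun x => ?_, hasSum_averagedComb A B θ S hη hη',
    averagedCombCoeff_zero hne (fun q hq => (hS q hq).1) hAB _,
    ⟨_, fun n => (norm_averagedCombCoeff_le_sinc A B θ S _ n).trans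
      (sinc_sq_le_decay (by positivity) n)⟩, fun n hn => ?_⟩
  · unfold averagedComb
    exact (continuous_finsetSum _ fun q _ => (continuous_tentComb ..).div_const _).div_const _
  · exact div_nonneg (Finset.sum_nonneg fun q _ =>
      div_nonneg (tentComb_nonneg _ _ _ _ hη x) (Nat.cast_nonneg _)) (Nat.cast_nonneg _)
  · have hn1 : 1 ≤ |(n : ℝ)| := by exact_mod_cast Int.one_le_abs hn
    have hn0 : 0 < |(n : ℝ)| := by linarith
    -- The extra `e` in `β` cancels the growth `|n| ^ e` of the divisor bound, leaving `|n| ^ (-s)`.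
    have h1 := sinc_sq_le_rpow (X := X) (y := n) (β := s + e) hX0 (by exact_mod_cast hn)
      (by linarith) (by linarith)
    have h2 : |(n : ℝ)| ^ (-s) ≤ 2 * (1 + |(n : ℝ)|) ^ (-s) := by
      calc |(n : ℝ)| ^ (-s) ≤ ((1 + |(n : ℝ)|) / 2) ^ (-s) :=
            Real.rpow_le_rpow_of_nonpos (by positivity) (by linarith) (by linarith)
        _ = 2 ^ s * (1 + |(n : ℝ)|) ^ (-s) := by
            rw [Real.div_rpow (by positivity) (by norm_num), Real.rpow_neg (by norm_num : (0 : ℝ) ≤ 2)]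
            field_simp
        _ ≤ 2 ^ (1 : ℝ) * (1 + |(n : ℝ)|) ^ (-s) := by
            gcongr
            · norm_num
            · linarith
        _ = _ := by rw [Real.rpow_one]
    have hc : (0 : ℝ) < S.card := by exact_mod_cast hne.card_pos
    refine (norm_averagedCombCoeff_le hX hS hAB he hK0 hK _ hn).trans ?_
    rw [mul_one_div]
    calc _ ≤ 2 * (X / |(n : ℝ)|) ^ (s + e) *
          (K ^ 2 * (X : ℝ) ^ e * |(n : ℝ)| ^ e * (1 + Real.log X) / S.card) := by gcongr
      _ = 2 * K ^ 2 * (1 + Real.log X) * (X : ℝ) ^ (s + 2 * e) / S.card * |(n : ℝ)| ^ (-s) := by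
          rw [Real.div_rpow hX0.le hn0.le, show s + 2 * e = (s + e) + e by ring,
            Real.rpow_add hX0 (s + e) e, Real.rpow_add hn0, Real.rpow_neg hn0.le]
          field_simp
      _ ≤ 2 * K ^ 2 * (1 + Real.log X) * (X : ℝ) ^ (s + 2 * e) / S.card *
          (2 * (1 + |(n : ℝ)|) ^ (-s)) := by gcongr
      _ = _ := by ring

lemma tendsto_one_add_mul_rpow {g : ℝ} (hg : 0 < g) :
    Tendsto (fun j : ℕ => (1 + (j : ℝ)) * (2 : ℝ) ^ (-(j * g))) atTop (𝓝 0) := by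
  have hr1 : (2 : ℝ) ^ (-g) < 1 := Real.rpow_lt_one_of_one_lt_of_neg (by norm_num) (by linarith)
  have h1 := tendsto_pow_atTop_nhds_zero_of_lt_one (r := (2 : ℝ) ^ (-g)) (by positivity) hr1
  have h2 := tendsto_self_mul_const_pow_of_lt_one (r := (2 : ℝ) ^ (-g)) (by positivity) hr1
  have h3 := h1.add h2
  rw [add_zero] at h3
  refine h3.congr fun j => ?_
  rw [← Real.rpow_natCast, ← Real.rpow_mul (by norm_num)]
  ring_nf

/-! ### The lower bound and the conclusion -/

lemma exists_measure_approxSet {Q : Set ℕ} (hQ : ∀ q ∈ Q, 0 < q) {A B : ℕ → ℤ}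
    (hAB : ∀ q ∈ Q, Int.gcd (A q) (B q) = 1) {ψ θ : Q → ℝ} (hψ : ∀ q : Q, 0 ≤ ψ q ∧ ψ q < 1 / 2)
    {s : ℝ} (hs0 : 0 ≤ s) (hs1 : s ≤ 1 / 2) (hs : s < convExponent Q ψ) :
    ∃ ν : Measure ℝ, IsProbabilityMeasure ν ∧ ν (approxSet Q ψ θ A B)ᶜ = 0 ∧
      ∃ C : ℝ, ∀ ξ, ‖measureFourier ν ξ‖ ≤ C * (1 + |ξ|) ^ (-s) := by
  classical
  obtain ⟨t', hst', ht'⟩ := exists_between hs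
  -- The cap at `1` ensures `e ≤ 1` below.
  set t := min t' 1 with htdef
  have hst : s < t := lt_min hst' (by linarith)
  have ht : t < convExponent Q ψ := (min_le_left _ _).trans_lt ht'
  have ht1 : t ≤ 1 := min_le_right _ _
  -- Then `s + 2 e = (s + t) / 2 < t`, so `2 ^ (j (s + 2 e))` is beaten by a level count of at least
  -- `2 ^ (j t)`, with room for the logarithm.
  set e := (t - s) / 4 with he
  have he0 : 0 < e := by rw [he]; linarith
  obtain ⟨K, hK0, hK⟩ := exists_card_divisors_le_rpow he0
  let Θ : ℕ → ℝ := fun q => if h : q ∈ Q then θ ⟨q, h⟩ else 0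
  have hΘ : ∀ q : Q, Θ q = θ q := fun q => by simp [Θ]
  let S : ℕ → Finset ℕ := fun j => (finite_dyadicLevel hQ hψ j).toFinset.image Subtype.val
  have hSmem : ∀ j, ∀ q ∈ S j, ∃ q' : Q, (q' : ℕ) = q ∧ q' ∈ dyadicLevel ψ j := by
    intro j q hq
    obtain ⟨q', hq', rfl⟩ := Finset.mem_image.1 hq
    exact ⟨q', rfl, (Set.Finite.mem_toFinset _).1 hq'⟩
  have hScard : ∀ j, (S j).card = (finite_dyadicLevel hQ hψ j).toFinset.card := fun j =>
    Finset.card_image_of_injective _ Subtype.val_injective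
  have hSX : ∀ j, ∀ q ∈ S j, 0 < q ∧ q ≤ 2 ^ j := by
    intro j q hq
    obtain ⟨q', rfl, hq'⟩ := hSmem j q hq
    exact ⟨hQ q' q'.2, le_two_pow_of_mem_dyadicLevel hQ hψ hq'⟩
  have hSAB : ∀ j, ∀ q ∈ S j, Int.gcd (A q) (B q) = 1 := by
    intro j q hq
    obtain ⟨q', rfl, -⟩ := hSmem j q hq
    exact hAB q' q'.2
  let δ : ℕ → ℝ := fun j => 1 / (4 * ((2 ^ j : ℕ) : ℝ))
  have hδ0 : ∀ j, 0 < δ j := fun j => by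
    have : (0 : ℝ) < ((2 ^ j : ℕ) : ℝ) := by positivity
    positivity
  have hδ2 : ∀ j, 2 * δ j = (1 / 2) ^ (j + 1) := by
    intro j
    simp only [δ]
    push_cast
    rw [one_div_pow, pow_succ]
    field_simp
    norm_num
  -- The multiplier uses tents of half-width `δ j`, while `Z j` is a closed superlevel set of combs
  -- of twice that width. It contains every point where the multiplier is nonzero, yet its points
  -- lie within `2 δ j = 2 ^ (-(j + 1)) < ψ q / q` of admissible points.
  let Z : ℕ → Set ℝ := fun j =>
    {x | 1 / (4 * δ j) ≤ ∑ q ∈ S j, tentComb q (A q) (B q) (Θ q) (2 * δ j) x}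
  have hZclosed : ∀ j, IsClosed (Z j) := fun j =>
    isClosed_le continuous_const (continuous_finsetSum _ fun q _ => continuous_tentComb ..)
  have hZmem : ∀ j, ∀ x ∈ Z j, ∃ (p : ℤ) (q : Q), q ∈ dyadicLevel ψ j ∧
      |x - (p + θ q) / (q : ℕ)| < ψ q / (q : ℕ) ∧ Int.gcd (B q * p + A q) (q : ℕ) = 1 := by
    intro j x hx
    have hpos : 0 < 1 / (4 * δ j) := by
      have := hδ0 j
      positivity
    have hne : ∑ q ∈ S j, tentComb q (A q) (B q) (Θ q) (2 * δ j) x ≠ 0 :=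
      (hpos.trans_le hx).ne'
    obtain ⟨q, hq, hq2⟩ := Finset.exists_ne_zero_of_sum_ne_zero hne
    obtain ⟨p, hp1, hp2⟩ := exists_of_tentComb_ne_zero (hSX j q hq).1
      (by linarith [hδ0 j]) hq2
    obtain ⟨q', rfl, hq'⟩ := hSmem j q hq
    rw [hΘ, hδ2] at hp1
    exact ⟨p, q', hq', hp1.trans hq'.1, hp2⟩
  have hmult : ∀ ε : ℝ, 0 < ε → ∀ J : ℕ, ∃ j, J ≤ j ∧ ∃ (F : ℝ → ℝ) (c : ℤ → ℂ),
      IsMultiplier s ε F c ∧ ∀ x, F x ≠ 0 → x ∈ Z j := by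
    intro ε hε J
    have htend := (tendsto_one_add_mul_rpow (g := (t - s) / 2) (by linarith)).const_mul (4 * K ^ 2)
    rw [mul_zero] at htend
    obtain ⟨J', hJ'⟩ := eventually_atTop.1 (htend.eventually (gt_mem_nhds hε))
    obtain ⟨j, hj, hcard⟩ := exists_large_dyadicLevel hQ hψ (by linarith) ht (max J J')
    rw [← hScard] at hcard
    have hcpos : (0 : ℝ) < (S j).card := lt_of_lt_of_le (by positivity) hcard
    have hne : (S j).Nonempty := Finset.card_pos.1 (by exact_mod_cast hcpos)
    have hmul := isMultiplier_averagedComb (A := A) (B := B) (θ := Θ) (S := S j) (X := 2 ^ j)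
      (by positivity) hne (hSX j) (hSAB j) hs0 hs1 he0.le (by rw [he]; linarith) hK0.le hK
    have hsmall : 4 * K ^ 2 * (1 + Real.log ((2 ^ j : ℕ) : ℝ)) *
        ((2 ^ j : ℕ) : ℝ) ^ (s + 2 * e) / (S j).card ≤ ε := by
      refine le_trans ?_ (hJ' j ((le_max_right _ _).trans hj)).le
      have hlog : Real.log ((2 ^ j : ℕ) : ℝ) ≤ j := by
        push_cast
        rw [Real.log_pow]
        have : Real.log 2 ≤ 1 := by linarith [Real.log_two_lt_d9]
        exact mul_le_of_le_one_right (Nat.cast_nonneg j) this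
      have hpow : ((2 ^ j : ℕ) : ℝ) ^ (s + 2 * e) = 2 ^ (j * t) * 2 ^ (-(j * ((t - s) / 2))) := by
        push_cast
        rw [← Real.rpow_natCast, ← Real.rpow_mul (by norm_num), ← Real.rpow_add (by norm_num), he]
        congr 1
        ring
      rw [div_le_iff₀ hcpos, hpow]
      calc _ ≤ 4 * K ^ 2 * (1 + j) * (((S j).card : ℝ) * 2 ^ (-(j * ((t - s) / 2)))) := by
            gcongr
        _ = _ := by ring
    refine ⟨j, (le_max_left _ _).trans hj, _, _, ⟨hmul.continuous, hmul.nonneg, hmul.hasSum,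
      hmul.coeff_zero, hmul.decay_two, fun n hn => (hmul.decay n hn).trans (by gcongr)⟩,
      fun x hx => ?_⟩
    have hx' := left_ne_zero_of_mul (show _ * _ ≠ (0 : ℝ) by
      rw [averagedComb, div_eq_mul_inv] at hx
      exact hx)
    obtain ⟨q, hq, hq2⟩ := Finset.exists_ne_zero_of_sum_ne_zero hx'
    have hq3 : tentComb q (A q) (B q) (Θ q) (δ j) x ≠ 0 := by
      intro h0
      exact hq2 (by rw [h0, zero_div])
    obtain ⟨p, hp1, hp2⟩ := exists_of_tentComb_ne_zero (hSX j q hq).1 (hδ0 j) hq3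
    exact (le_tentComb (hSX j q hq).1 (hδ0 j) hp2 hp1.le).trans
      (Finset.single_le_sum (f := fun q => tentComb q (A q) (B q) (Θ q) (2 * δ j) x)
        (fun q _ => tentComb_nonneg _ _ _ _ (by linarith [hδ0 j]) x) hq)
  obtain ⟨ν, hν, hae, hC⟩ := exists_measure_of_multipliers hs0 hs1 hZclosed hmult
  refine ⟨ν, hν, ?_, hC⟩
  change ∀ᵐ x ∂ν, x ∈ approxSet Q ψ θ A B
  filter_upwards [hae] with x hx
  refine ⟨hx.1, ?_⟩
  obtain ⟨j₀, hj₀⟩ := hx.2.nonempty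
  obtain ⟨-, q₀, -⟩ := hZmem j₀ x hj₀
  have : Nonempty Q := ⟨q₀⟩
  have hex := fun j (hj : j ∈ {j | x ∈ Z j}) => hZmem j x hj
  choose! p q hq hpq using hex
  -- Dyadic levels are disjoint, so distinct `j` produce distinct denominators.
  refine Set.infinite_of_injOn_mapsTo (f := fun j => (p j, q j)) ?_ (fun j hj => hpq j hj) hx.2
  intro j hj k hk hjk
  have h1 : q j = q k := congrArg Prod.snd hjk
  exact dyadicLevel_unique (hq j hj) (h1 ▸ hq k hk)

end

theorem theorem1 (Q : Set ℕ) (hQ : ∀ q ∈ Q, 0 < q)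
    (A B : ℕ → ℤ) (hB : ∀ q ∈ Q, 0 < B q) (hAB : ∀ q ∈ Q, Int.gcd (A q) (B q) = 1)
    (ψ θ : Q → ℝ) (hψ : ∀ q : Q, 0 ≤ ψ q ∧ ψ q < 1 / 2)
    (hconv : Summable fun q : Q => ψ q * coprimeDensity q (B q)) :
    fourierDim (approxSet Q ψ θ A B) = min (2 * convExponent Q ψ) 1 := by
  have hconv0 : 0 ≤ convExponent Q ψ := Real.sInf_nonneg fun x hx => hx.1
  unfold fourierDim
  apply le_antisymm
  · refine Real.sSup_le ?_ (le_min (by positivity) zero_le_one)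
    rintro s ⟨hs, ν, hν, hνE, C, hC⟩
    exact le_min (fourierDim_exponent_le hQ hAB hψ hconv hs hνE hC) hs.2
  -- The supremum need not be attained, so only exponents strictly below the minimum are realized.
  · refine le_of_forall_lt_imp_le_of_dense fun s hs => ?_
    rcases lt_or_ge s 0 with hneg | hs0
    · exact hneg.le.trans (Real.sSup_nonneg fun x hx => hx.1.1)
    · have h1 : s < 2 * convExponent Q ψ := hs.trans_le (min_le_left _ _)
      have h2 : s < 1 := hs.trans_le (min_le_right _ _)
      obtain ⟨ν, hν, hνE, C, hC⟩ := exists_measure_approxSet (θ := θ) hQ hAB hψ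
        (s := s / 2) (by linarith) (by linarith) (by linarith)
      refine le_csSup ⟨1, fun x hx => hx.1.2⟩ ⟨⟨hs0, h2.le⟩, ν, hν, hνE, C, fun ξ => ?_⟩
      rw [neg_div]
      exact hC ξ
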